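/- Let $G$, $G'$ be groups and let $q:G'\to G$ be a surjective homomorphism with finite kernel $\Gamma=\operatorname{Ker} q$. Let $W$ be a closed connected oriented surface of genus $d\ge 1$ with fundamental group $\pi=\pi_1(W)$ (with respect to any base point). For a homomorphism $g:\pi\to G$, let $\mathrm{Hom}_g(\pi,G')$ be the set of all homomorphisms $g':\pi\to G'$ such that $q\circ g'=g$. Then, for every homomorphism $g:\pi\to G$, the set $\mathrm{Hom}_g(\pi,G')$ is finite (possibly empty), and the number $|\mathrm{Hom}_g(\pi,G')|$ of its elements is divisible by $|\Gamma|\cdot|Z(\Gamma)|^{2d-2}$, where $Z(\Gamma)$ is the center of $\Gamma$. -/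

import Mathlib

/-- The point with parameter `s` on the boundary circle of the closed unit disc in `ℂ`, viewed as
a `4 * d`-gon: for `k < 4 * d`, the `k`-th side is the arc `k ≤ s ≤ k + 1`, traversed
counterclockwise. -/
noncomputable def polygonPoint (d : ℕ) (s : ℝ) : ℂ :=
  Complex.exp (((2 * Real.pi * s / (4 * (d : ℝ)) : ℝ) : ℂ) * Complex.I)

/-- The side identifications of the `4 * d`-gon according to the word
`a₁ b₁ a₁⁻¹ b₁⁻¹ ⋯ a_d b_d a_d⁻¹ b_d⁻¹`: in the `j`-th block of four consecutive sides, the first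
side is glued to the third and the second side to the fourth, each time reversing the direction. -/
def PolygonGluing (d : ℕ) (x y : Metric.closedBall (0 : ℂ) 1) : Prop :=
  ∃ j : ℕ, j < d ∧ ∃ t : ℝ, 0 ≤ t ∧ t ≤ 1 ∧
    (((x : ℂ) = polygonPoint d (4 * j + t) ∧
        (y : ℂ) = polygonPoint d (4 * j + 2 + (1 - t))) ∨
      ((x : ℂ) = polygonPoint d (4 * j + 1 + t) ∧
        (y : ℂ) = polygonPoint d (4 * j + 3 + (1 - t))))

/-- For `d ≥ 1`, the standard closed orientable surface with `d` handles: the `4 * d`-gon with its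
sides identified, with the quotient topology (`Quot` divides by the equivalence relation generated
by the gluing). -/
abbrev PolygonSurface (d : ℕ) : Type :=
  Quot (PolygonGluing d)

/-- `W` is a closed connected orientable surface of genus `d`: it is homeomorphic to the sphere
`S²` if `d = 0`, and to the standard surface with `d` handles (the connected sum of `d` tori)
if `d ≥ 1`. -/
def IsClosedOrientableSurfaceOfGenus (W : Type*) [TopologicalSpace W] (d : ℕ) : Prop :=
  if d = 0 then Nonempty (W ≃ₜ Metric.sphere (0 : EuclideanSpace ℝ (Fin 3)) 1)
  else Nonempty (W ≃ₜ PolygonSurface d)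

/-- The set `Hom_g(π, G')` of lifts of a homomorphism `g : π → G` along `q : G' → G`. -/
def homLifts {π G G' : Type*} [Group π] [Group G] [Group G'] (q : G' →* G) (g : π →* G) :
    Set (π →* G') :=
  {g' | q.comp g' = g}

/-! Write K for Γ. The standard presentation of π turns the lifts of g into the tuples (kᵢ, lᵢ) in K
with ∏ ⁅αᵢkᵢ, βᵢlᵢ⁆ = 1, where αᵢ, βᵢ are chosen preimages of the images of the generators
(`IsSurfaceBasis.homLiftsEquiv`). Finiteness follows, and the rest is a count of solutions.

Translating a variable by an element of Z(K) multiplies the product by an element of Z(K), possibly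
nontrivial, since αᵢ and βᵢ may act on Z(K). Let N be the group of all z in Z(K) such that, for
every u, the equations with right-hand sides u and zu have equally many solutions. All αᵢ, βᵢ act
trivially on Z(K)/N (`mem_periodCentralizer_of_mem`), so translations by Z(K) preserve the solutions
counted modulo N. Each pair after the first thus contributes |Z(K)|². For the first pair, K × N acts
on α₁K by conjugation and translation, and the stabilizer of a point acts freely on β₁K by
translation; together these give |K||N| (`dvd_averagedCount_cons_one`). Counting modulo N multiplied
the number of solutions by |N|, which cancels.

The presentation of π comes from the polygon. Labels of the vertices by elements of a group H that
satisfy the relation define a covering with group H, and its monodromy is the homomorphism with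
prescribed values on the generators (`isQuotientCoveringMap_boundaryLabel`,
`TwistedCover.exists_hom`). The generators suffice because each path in the surface is locally
homotopic to a product of images of paths in the disc (`eq_top_of_locally_contractible`). -/

section OrbitSum

/-! ### Divisibility of sums invariant under a group action -/

variable {H A : Type*} [Group H] [MulAction H A] [Fintype A]

/-- The orbit of `a` contributes |orbit| · `f a`, and |orbit| · |stabilizer| = |H|. -/
theorem card_mul_dvd_sum_of_card_stabilizer_mul_dvd [Finite H] {c : ℕ} {f : A → ℕ}
    (hf : ∀ (h : H) a, f (h • a) = f a)
    (hc : ∀ a, Nat.card (MulAction.stabilizer H a) * c ∣ f a) :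
    Nat.card H * c ∣ ∑ a, f a := by
  classical
  let r := MulAction.orbitRel H A
  rw [← Finset.sum_fiberwise (s := Finset.univ) (g := fun a => (Quotient.mk r a)) (f := f)]
  refine Finset.dvd_sum fun ω _ => ?_
  induction ω using Quotient.inductionOn with
  | h a =>
    have h1 : ∀ b ∈ Finset.univ.filter (fun b => Quotient.mk r b = Quotient.mk r a),
        f b = f a := by
      intro b hb
      have hb' : b ∈ MulAction.orbit H a := by
        have := (Finset.mem_filter.1 hb).2
        exact (MulAction.orbitRel_apply).1 (Quotient.exact this)
      obtain ⟨h, rfl⟩ := hb'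
      exact hf h a
    rw [Finset.sum_congr rfl h1, Finset.sum_const, smul_eq_mul]
    have h2 : (Finset.univ.filter (fun b => Quotient.mk r b = Quotient.mk r a)).card
        = Nat.card (MulAction.orbit H a) := by
      rw [← Fintype.card_subtype, ← Nat.card_eq_fintype_card]
      exact Nat.card_congr (Equiv.subtypeEquivRight fun b =>
        ⟨fun h => MulAction.orbitRel_apply.1 (Quotient.exact h),
          fun h => Quotient.sound (MulAction.orbitRel_apply.2 h)⟩)
    obtain ⟨m, hm⟩ := hc a
    have h3 : Nat.card (MulAction.orbit H a) * Nat.card (MulAction.stabilizer H a) = Nat.card H := by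
      rw [← Nat.card_prod]
      exact Nat.card_congr (MulAction.orbitProdStabilizerEquivGroup H a)
    exact ⟨m, by rw [h2, hm, ← h3]; ring⟩

end OrbitSum

/-! ### Counting products of commutators in cosets, and the central periods of the count -/

section CommutatorCount

open scoped commutatorElement

variable {G : Type*} [Group G] (K : Subgroup G) [Fintype K]

open Classical in
/-- The number of ways to write `u` as a product of commutators `⁅α * k, β * l⁆`, where `(α, β)`
runs through the given list and `k`, `l` are in `K`. -/
noncomputable def commutatorCount : List (G × G) → G → ℕ
  | [], u => if u = 1 then 1 else 0
  | p :: L, u => ∑ k : K, ∑ l : K, commutatorCount L (⁅p.1 * k, p.2 * l⁆⁻¹ * u)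

/-- The elements of `K` commuting with all of `K`, as a subgroup of the ambient group. -/
abbrev centerIn : Subgroup G := (Subgroup.center K).map K.subtype

variable {K}

omit [Fintype K] in
theorem mem_centerIn {z : G} : z ∈ centerIn K ↔ z ∈ K ∧ ∀ k ∈ K, k * z = z * k := by
  simp [centerIn, Subgroup.mem_center_iff, Subtype.ext_iff, and_comm]

omit [Fintype K] in
theorem centerIn_commute {z y : G} (hz : z ∈ centerIn K) (hy : y ∈ centerIn K) : z * y = y * z :=
  (mem_centerIn.1 hy).2 z (mem_centerIn.1 hz).1

omit [Fintype K] in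
theorem conj_mem_centerIn [K.Normal] {z : G} (hz : z ∈ centerIn K) (g : G) :
    g * z * g⁻¹ ∈ centerIn K := by
  rw [mem_centerIn] at hz ⊢
  refine ⟨Subgroup.Normal.conj_mem ‹_› _ hz.1 g, fun k hk => ?_⟩
  have := hz.2 _ (Subgroup.Normal.conj_mem ‹K.Normal› _ hk g⁻¹)
  calc k * (g * z * g⁻¹) = g * (g⁻¹ * k * g⁻¹⁻¹ * z) * g⁻¹ := by group
    _ = g * (z * (g⁻¹ * k * g⁻¹⁻¹)) * g⁻¹ := by rw [this]
    _ = _ := by group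

theorem conj_mem_centerIn' [K.Normal] {z : G} (hz : z ∈ centerIn K) (g : G) :
    g⁻¹ * z * g ∈ centerIn K := by
  simpa using conj_mem_centerIn hz g⁻¹

omit [Fintype K] in
/-- Replacing `g` by `g * k` does not change the conjugation action on the center of `K`. -/
theorem conj_mul_right {z : G} (hz : z ∈ centerIn K) (g : G) {k : G} (hk : k ∈ K) :
    g * k * z * (g * k)⁻¹ = g * z * g⁻¹ := by
  have := (mem_centerIn.1 hz).2 k hk
  calc g * k * z * (g * k)⁻¹ = g * (k * z) * k⁻¹ * g⁻¹ := by group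
    _ = g * (z * k) * k⁻¹ * g⁻¹ := by rw [this]
    _ = _ := by group

theorem inv_conj_mul_right [K.Normal] {z : G} (hz : z ∈ centerIn K) (g : G) {k : G} (hk : k ∈ K) :
    (g * k)⁻¹ * z * (g * k) = g⁻¹ * z * g := by
  have := (mem_centerIn.1 (conj_mem_centerIn' hz g)).2 k hk
  calc (g * k)⁻¹ * z * (g * k) = k⁻¹ * (g⁻¹ * z * g * k) := by group
    _ = k⁻¹ * (k * (g⁻¹ * z * g)) := by rw [this]
    _ = _ := by group

omit [Fintype K] in
theorem inv_mul_commutator_mem [K.Normal] (a b : G) {k l : G} (hk : k ∈ K) (hl : l ∈ K) :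
    ⁅a, b⁆⁻¹ * ⁅a * k, b * l⁆ ∈ K := by
  rw [← QuotientGroup.eq]
  have hk' : (k : G ⧸ K) = 1 := (QuotientGroup.eq_one_iff k).2 hk
  have hl' : (l : G ⧸ K) = 1 := (QuotientGroup.eq_one_iff l).2 hl
  simp [commutatorElement_def, hk', hl']

variable (K) in
/-- The elements of the center of `K` whose multiplication leaves the commutator count
invariant. -/
def countPeriods (L : List (G × G)) : Subgroup G where
  carrier := {z | z ∈ centerIn K ∧ ∀ u, commutatorCount K L (z * u) = commutatorCount K L u}
  one_mem' := ⟨one_mem _, by simp⟩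
  mul_mem' := by
    rintro a b ⟨ha, ha'⟩ ⟨hb, hb'⟩
    exact ⟨mul_mem ha hb, fun u => by rw [mul_assoc, ha', hb']⟩
  inv_mem' := by
    rintro a ⟨ha, ha'⟩
    exact ⟨inv_mem ha, fun u => by rw [← ha', mul_inv_cancel_left]⟩

variable (K) in
/-- The elements acting trivially on the center of `K` modulo `countPeriods`. -/
def periodCentralizer [K.Normal] (L : List (G × G)) : Subgroup G where
  carrier := {h | ∀ z ∈ centerIn K, z * (h * z⁻¹ * h⁻¹) ∈ countPeriods K L}
  one_mem' := fun z hz => by simp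
  mul_mem' := by
    intro a b ha hb z hz
    have h1 := hb z hz
    have h1z : z * (b * z⁻¹ * b⁻¹) ∈ centerIn K := h1.1
    -- For y = z(bz⁻¹b⁻¹) this puts y⁻¹ · aya⁻¹ among the periods. Hence aya⁻¹ is a period, although
    -- invariance of the periods under `a` was not assumed.
    have h3 := ha _ (inv_mem h1z)
    have e : z * (a * b * z⁻¹ * (a * b)⁻¹) = (z * (a * z⁻¹ * a⁻¹)) * ((z * (b * z⁻¹ * b⁻¹)) *
        ((z * (b * z⁻¹ * b⁻¹))⁻¹ * (a * (z * (b * z⁻¹ * b⁻¹))⁻¹⁻¹ * a⁻¹))) := by group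
    rw [e]
    exact mul_mem (ha z hz) (mul_mem h1 h3)
  inv_mem' := by
    intro h hh z hz
    have h1 := hh _ (conj_mem_centerIn' hz h)
    have e : z * (h⁻¹ * z⁻¹ * h⁻¹⁻¹) = ((h⁻¹ * z * h) * (h * (h⁻¹ * z * h)⁻¹ * h⁻¹))⁻¹ := by group
    rw [e]
    exact inv_mem h1

theorem conj_mem_countPeriods [K.Normal] {L : List (G × G)} {z h : G}
    (hz : z ∈ countPeriods K L) (hh : h ∈ periodCentralizer K L) :
    h * z * h⁻¹ ∈ countPeriods K L := by
  have h1 := hh _ (inv_mem hz.1)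
  have := mul_mem hz h1
  simpa [mul_assoc] using this

/-- The coset αK is stable under multiplication by K on both sides. This reindexing covers
conjugation by K as well as translation by its center. -/
theorem sum_conj_coset [K.Normal] (f : G → ℕ) (α : G) {x y : G} (hx : x ∈ K) (hy : y ∈ K) :
    ∑ k : K, f (x * (α * k) * y) = ∑ k : K, f (α * k) := by
  have hx' : α⁻¹ * x * α ∈ K := by simpa using Subgroup.Normal.conj_mem ‹K.Normal› _ hx α⁻¹
  refine Fintype.sum_equiv ((Equiv.mulLeft ⟨_, hx'⟩).trans (Equiv.mulRight ⟨y, hy⟩)) _ _ fun k => ?_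
  congr 1
  simp [mul_assoc]

/-- Conjugating every variable by `x` permutes the cosets and conjugates the product. -/
theorem commutatorCount_conj [K.Normal] (L : List (G × G)) {x : G} (hx : x ∈ K) (u : G) :
    commutatorCount K L (x * u * x⁻¹) = commutatorCount K L u := by
  induction L generalizing u with
  | nil =>
    simp only [commutatorCount]
    by_cases h : u = 1
    · simp [h]
    · rw [if_neg h, if_neg (mt conj_eq_one_iff.1 h)]
  | cons p L ih =>
    have hx' := inv_mem hx
    simp only [commutatorCount]
    rw [← sum_conj_coset (fun a => ∑ l : K, commutatorCount K L (⁅a, p.2 * l⁆⁻¹ * u)) p.1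
      hx' hx]
    refine Finset.sum_congr rfl fun k _ => ?_
    rw [← sum_conj_coset (fun b => commutatorCount K L (⁅x⁻¹ * (p.1 * k) * x, b⁆⁻¹ * u)) p.2
      hx' hx]
    refine Finset.sum_congr rfl fun l _ => ?_
    conv_rhs => rw [← ih]
    congr 1
    simp only [commutatorElement_def]
    group

section Cons

variable [K.Normal] {p : G × G} {L : List (G × G)}

/-- Substitute az for a: ⁅az, b⁆ = a(z · bz⁻¹b⁻¹)a⁻¹ · ⁅a, b⁆. The extra factor is central in K and
does not depend on the representatives of the cosets. -/
theorem conj_fst_mem_countPeriods {z : G} (hz : z ∈ centerIn K) :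
    p.1 * (z * (p.2 * z⁻¹ * p.2⁻¹)) * p.1⁻¹ ∈ countPeriods K (p :: L) := by
  have hz' := inv_mem hz
  refine ⟨conj_mem_centerIn (mul_mem hz (conj_mem_centerIn hz' _)) _, fun u => ?_⟩
  simp only [commutatorCount]
  rw [← sum_conj_coset (fun a => ∑ l : K, commutatorCount K L (⁅a, p.2 * l⁆⁻¹ *
    (p.1 * (z * (p.2 * z⁻¹ * p.2⁻¹)) * p.1⁻¹ * u))) p.1 (one_mem K) (mem_centerIn.1 hz).1]
  refine Finset.sum_congr rfl fun k _ => Finset.sum_congr rfl fun l _ => ?_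
  congr 1
  rw [← conj_mul_right hz' p.2 l.2, ← conj_mul_right (mul_mem hz (conj_mem_centerIn hz' _)) p.1 k.2]
  simp only [commutatorElement_def]
  group

/-- Substitute bz for b: ⁅a, bz⁆ = ab(z · a⁻¹z⁻¹a)(ab)⁻¹ · ⁅a, b⁆. -/
theorem conj_mul_mem_countPeriods {z : G} (hz : z ∈ centerIn K) :
    p.1 * (p.2 * (z * (p.1⁻¹ * z⁻¹ * p.1)) * p.2⁻¹) * p.1⁻¹ ∈ countPeriods K (p :: L) := by
  have hz' := inv_mem hz
  have h1 := mul_mem hz (conj_mem_centerIn' hz' p.1)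
  have h2 := conj_mem_centerIn h1 p.2
  refine ⟨conj_mem_centerIn h2 _, fun u => ?_⟩
  simp only [commutatorCount]
  refine Finset.sum_congr rfl fun k _ => ?_
  rw [← sum_conj_coset (fun b => commutatorCount K L (⁅p.1 * ↑k, b⁆⁻¹ *
    (p.1 * (p.2 * (z * (p.1⁻¹ * z⁻¹ * p.1)) * p.2⁻¹) * p.1⁻¹ * u))) p.2 (one_mem K)
    (mem_centerIn.1 hz).1]
  refine Finset.sum_congr rfl fun l _ => ?_
  congr 1
  rw [← conj_mul_right h2 p.1 k.2, ← conj_mul_right h1 p.2 l.2, ← inv_conj_mul_right hz' p.1 k.2]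
  simp only [commutatorElement_def]
  group

/-- With a, b the entries of `p`, the two kinds of periods show that aba⁻¹ and aba⁻¹(ab)⁻¹ act
trivially; these two elements generate a and b. -/
theorem fst_snd_mem_periodCentralizer :
    p.1 ∈ periodCentralizer K (p :: L) ∧ p.2 ∈ periodCentralizer K (p :: L) := by
  set T := periodCentralizer K (p :: L)
  have h1 : p.1 * p.2 * p.1⁻¹ ∈ T := by
    intro z hz
    have := conj_fst_mem_countPeriods (p := p) (L := L) (conj_mem_centerIn' hz p.1)
    convert this using 1
    group
  have h2 : p.1 * p.2 * p.1⁻¹ * (p.1 * p.2)⁻¹ ∈ T := by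
    intro z hz
    have := conj_mul_mem_countPeriods (p := p) (L := L) (conj_mem_centerIn' hz (p.1 * p.2))
    convert this using 1
    group
  have h3 : p.1 * p.2 ∈ T := by
    simpa [mul_assoc] using mul_mem (inv_mem h2) h1
  have h4 : p.1 ∈ T := by
    have := mul_mem (inv_mem h1) h3
    simpa [mul_assoc] using this
  refine ⟨h4, ?_⟩
  simpa using mul_mem (inv_mem h4) h3

/-- ⁅a, b⁆ and ⁅ak, bl⁆ differ by an element of K, so they conjugate `y` in the same way, and moving
`y` past the first commutator leaves a period of the tail. -/
theorem conj_commutator_mem_countPeriods {y : G} (hy : y ∈ countPeriods K L) :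
    ⁅p.1, p.2⁆ * y * ⁅p.1, p.2⁆⁻¹ ∈ countPeriods K (p :: L) := by
  refine ⟨conj_mem_centerIn hy.1 _, fun u => ?_⟩
  simp only [commutatorCount]
  refine Finset.sum_congr rfl fun k _ => Finset.sum_congr rfl fun l _ => ?_
  conv_rhs => rw [← hy.2]
  congr 1
  rw [← conj_mul_right hy.1 ⁅p.1, p.2⁆ (inv_mul_commutator_mem p.1 p.2 k.2 l.2)]
  group

/-- The previous lemma gives this only after conjugation by w = ⁅a, b⁆. Since w itself lies in the
larger subgroup, the conjugation can be undone. -/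
theorem periodCentralizer_le_cons :
    periodCentralizer K L ≤ periodCentralizer K (p :: L) := by
  intro h hh
  obtain ⟨h1, h2⟩ := fst_snd_mem_periodCentralizer (K := K) (p := p) (L := L)
  set w := ⁅p.1, p.2⁆ with hw
  have hwT : w ∈ periodCentralizer K (p :: L) := by
    rw [hw, commutatorElement_def]
    exact mul_mem (mul_mem (mul_mem h1 h2) (inv_mem h1)) (inv_mem h2)
  have h3 : w * h * w⁻¹ ∈ periodCentralizer K (p :: L) := by
    intro z hz
    have := conj_commutator_mem_countPeriods (p := p) (hh _ (conj_mem_centerIn' hz w))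
    rw [← hw] at this
    convert this using 1
    group
  simpa [mul_assoc] using mul_mem (mul_mem (inv_mem hwT) h3) hwT

theorem mem_periodCentralizer_of_mem {q : G × G} {L : List (G × G)} (hq : q ∈ L) :
    q.1 ∈ periodCentralizer K L ∧ q.2 ∈ periodCentralizer K L := by
  induction L with
  | nil => simp at hq
  | cons p L ih =>
    rcases List.mem_cons.1 hq with rfl | hq
    · exact fst_snd_mem_periodCentralizer
    · exact ⟨periodCentralizer_le_cons (ih hq).1, periodCentralizer_le_cons (ih hq).2⟩

end Cons

/-! ### Counting modulo the periods -/

section Average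

variable [K.Normal] {N : Subgroup G} [Fintype N]

variable (K N) in
/-- The number of ways to write an element of the coset `u * N` as a product of commutators. -/
noncomputable def averagedCount (L : List (G × G)) (u : G) : ℕ :=
  ∑ n : N, commutatorCount K L (u * n)

omit [K.Normal] in
theorem averagedCount_mul (L : List (G × G)) (u : G) {n : G} (hn : n ∈ N) :
    averagedCount K N L (u * n) = averagedCount K N L u := by
  refine Fintype.sum_equiv (Equiv.mulLeft ⟨n, hn⟩) _ _ fun k => ?_
  simp [mul_assoc]

theorem averagedCount_conj (hN : N ≤ centerIn K) (L : List (G × G)) {x : G} (hx : x ∈ K) (u : G) :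
    averagedCount K N L (x * u * x⁻¹) = averagedCount K N L u := by
  refine Finset.sum_congr rfl fun n _ => ?_
  rw [← commutatorCount_conj L hx (u * n)]
  congr 1
  have := (mem_centerIn.1 (hN n.2)).2 _ (inv_mem hx)
  simp only [mul_assoc, this]

omit [K.Normal] in
theorem averagedCount_cons (p : G × G) (L : List (G × G)) (u : G) :
    averagedCount K N (p :: L) u =
      ∑ k : K, ∑ l : K, averagedCount K N L (⁅p.1 * k, p.2 * l⁆⁻¹ * u) := by
  simp only [averagedCount, commutatorCount]
  rw [Finset.sum_comm]
  refine Finset.sum_congr rfl fun k _ => ?_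
  rw [Finset.sum_comm]
  simp only [mul_assoc]

omit [K.Normal] in
/-- A function on `K` invariant under translations by the center of `K`. -/
theorem card_center_mul_dvd_sum {c : ℕ} {f : K → ℕ}
    (hf : ∀ k : K, ∀ z ∈ Subgroup.center K, f (k * z) = f k) (hc : ∀ k, c ∣ f k) :
    Nat.card (Subgroup.center K) * c ∣ ∑ k, f k := by
  refine card_mul_dvd_sum_of_card_stabilizer_mul_dvd (H := Subgroup.center K) ?_ ?_
  · intro z k
    rw [Subgroup.smul_def, smul_eq_mul, ← Subgroup.mem_center_iff.1 z.2, hf _ _ z.2]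
  · intro k
    have : MulAction.stabilizer (Subgroup.center K) k = ⊥ := by
      ext z
      simp
    simpa [this] using hc k

-- The hypothesis `hS` says that `S` embeds into `K`, so its translation action on `K` is free.
omit [K.Normal] in
theorem card_mul_dvd_sum_of_right_translation {M : Type*} [Group M] [Finite M]
    (S : Subgroup (K × M)) (hS : ∀ s ∈ S, s.1 = 1 → s = 1) {c : ℕ} {f : K → ℕ}
    (hf : ∀ s ∈ S, ∀ k, f (k * s.1) = f k) (hc : ∀ k, c ∣ f k) :
    Nat.card S * c ∣ ∑ k, f k := by
  let : MulAction S K :=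
    { smul := fun s k => k * s.1.1⁻¹
      one_smul := fun k => by change k * _ = k; simp
      mul_smul := fun s t k => by
        change k * (s * t).1.1⁻¹ = k * t.1.1⁻¹ * s.1.1⁻¹
        simp [mul_assoc] }
  refine card_mul_dvd_sum_of_card_stabilizer_mul_dvd (H := S) ?_ ?_
  · intro s k
    exact hf _ (inv_mem s.2) k
  · intro k
    have : MulAction.stabilizer S k = ⊥ := by
      refine (Subgroup.eq_bot_iff_forall _).2 fun s hs => ?_
      have h1 : k * s.1.1⁻¹ = k := hs
      have h2 : s.1.1 = 1 := by simpa using h1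
      exact Subtype.ext (hS s.1 s.2 h2)
    simpa [this] using hc k

/-- The action of `K × N` on the coset `α * K`, where `K` acts by conjugation and `N` by right
translation. -/
@[reducible] def cosetAction (α : G) (hN : N ≤ centerIn K) : MulAction (K × N) K where
  smul h k := ⟨α⁻¹ * (h.1 * (α * k) * (h.1 : G)⁻¹ * h.2), by
    have h1 : α⁻¹ * h.1 * α ∈ K := by
      simpa using Subgroup.Normal.conj_mem ‹K.Normal› _ h.1.2 α⁻¹
    have h2 := mul_mem (mul_mem (mul_mem h1 k.2) (inv_mem h.1.2)) (mem_centerIn.1 (hN h.2.2)).1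
    simpa [mul_assoc] using h2⟩
  one_smul k := Subtype.ext <| by
    change α⁻¹ * (_ * (α * (k : G)) * _ * _) = _
    simp
  mul_smul g h k := Subtype.ext <| by
    change α⁻¹ * (((g.1 * h.1 : K) : G) * (α * (k : G)) * ((g.1 * h.1 : K) : G)⁻¹ *
      ((g.2 * h.2 : N) : G)) = α⁻¹ * (g.1 * (α * (α⁻¹ * (h.1 * (α * k) * (h.1 : G)⁻¹ * h.2))) *
      (g.1 : G)⁻¹ * g.2)
    have h1 := (mem_centerIn.1 (hN h.2.2)).2 _ (inv_mem g.1.2)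
    have h2 := centerIn_commute (hN g.2.2) (hN h.2.2)
    push_cast
    calc _ = α⁻¹ * (g.1 * h.1 * (α * k) * (h.1 : G)⁻¹ * (g.1 : G)⁻¹ * (g.2 * h.2)) := by group
      _ = α⁻¹ * (g.1 * h.1 * (α * k) * (h.1 : G)⁻¹ * ((g.1 : G)⁻¹ * h.2) * g.2) := by
        rw [h2]; group
      _ = _ := by rw [h1]; group

variable {T : Subgroup G} (hN : N ≤ centerIn K) (hK : K ≤ T)
  (hTN : ∀ h ∈ T, ∀ n ∈ N, h * n * h⁻¹ ∈ N)
  (hT : ∀ h ∈ T, ∀ z ∈ centerIn K, z * (h * z⁻¹ * h⁻¹) ∈ N)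

omit [K.Normal] in
include hTN in
theorem averagedCount_mul_mul (L : List (G × G)) {u : G} (hu : u ∈ T) (v : G) {n : G}
    (hn : n ∈ N) : averagedCount K N L (v * n * u) = averagedCount K N L (v * u) := by
  have h1 : u⁻¹ * n * u ∈ N := by simpa using hTN _ (inv_mem hu) n hn
  rw [← averagedCount_mul L (v * u) h1]
  congr 1
  group

include hTN hT in
theorem averagedCount_commutator_mul_left (L : List (G × G)) {a b u z : G} (ha : a ∈ T)
    (hb : b ∈ T) (hu : u ∈ T) (hz : z ∈ centerIn K) :
    averagedCount K N L (⁅a * z, b⁆⁻¹ * u) = averagedCount K N L (⁅a, b⁆⁻¹ * u) := by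
  have h1 := inv_mem (hTN a ha _ (hT b hb z hz))
  rw [← averagedCount_mul_mul hTN L hu ⁅a, b⁆⁻¹ h1]
  congr 1
  simp only [commutatorElement_def]
  group

include hTN hT in
theorem averagedCount_commutator_mul_right (L : List (G × G)) {a b u z : G} (ha : a ∈ T)
    (hb : b ∈ T) (hu : u ∈ T) (hz : z ∈ centerIn K) :
    averagedCount K N L (⁅a, b * z⁆⁻¹ * u) = averagedCount K N L (⁅a, b⁆⁻¹ * u) := by
  have h1 := inv_mem (hTN _ (mul_mem ha hb) _ (hT a⁻¹ (inv_mem ha) z hz))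
  rw [← averagedCount_mul_mul hTN L hu ⁅a, b⁆⁻¹ h1]
  congr 1
  simp only [commutatorElement_def]
  group

-- Modulo `N` each commutator is unchanged when either entry is translated by Z(K). The translations
-- are free, so every pair gives two factors |Z(K)|.
include hK hTN hT in
theorem card_center_pow_dvd_averagedCount (L : List (G × G)) (hL : ∀ q ∈ L, q.1 ∈ T ∧ q.2 ∈ T)
    {u : G} (hu : u ∈ T) :
    Nat.card (Subgroup.center K) ^ (2 * L.length) ∣ averagedCount K N L u := by
  induction L generalizing u with
  | nil => simp
  | cons p L ih =>
    obtain ⟨hp, hL⟩ := List.forall_mem_cons.1 hL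
    have hzc : ∀ z ∈ Subgroup.center K, (z : G) ∈ centerIn K := fun z hz => ⟨z, hz, rfl⟩
    have hp1 : ∀ k : K, p.1 * k ∈ T := fun k => mul_mem hp.1 (hK k.2)
    have hp2 : ∀ k : K, p.2 * k ∈ T := fun k => mul_mem hp.2 (hK k.2)
    rw [averagedCount_cons, List.length_cons, mul_add, mul_one, pow_add, pow_two, mul_comm,
      mul_assoc]
    refine card_center_mul_dvd_sum (fun k z hz => ?_) fun k => ?_
    · refine Finset.sum_congr rfl fun l _ => ?_
      rw [Subgroup.coe_mul, ← mul_assoc]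
      exact averagedCount_commutator_mul_left hTN hT L (hp1 k) (hp2 l) hu (hzc z hz)
    · refine card_center_mul_dvd_sum (fun l z hz => ?_) fun l => ih hL ?_
      · rw [Subgroup.coe_mul, ← mul_assoc]
        exact averagedCount_commutator_mul_right hTN hT L (hp1 k) (hp2 l) hu (hzc z hz)
      · rw [commutatorElement_def]
        exact mul_mem (inv_mem (mul_mem (mul_mem (mul_mem (hp1 k) (hp2 l)) (inv_mem (hp1 k)))
          (inv_mem (hp2 l)))) hu

-- The right-hand side 1 is fixed by conjugation, so K acts on the solutions by simultaneous
-- conjugation; this is where |K| comes from. The tail supplies the powers of |Z(K)|.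
include hN hK hTN hT in
theorem dvd_averagedCount_cons_one (p : G × G) (L : List (G × G))
    (hL : ∀ q ∈ p :: L, q.1 ∈ T ∧ q.2 ∈ T) :
    Nat.card K * Nat.card N * Nat.card (Subgroup.center K) ^ (2 * L.length) ∣
      averagedCount K N (p :: L) 1 := by
  obtain ⟨hp, hL⟩ := List.forall_mem_cons.1 hL
  have hp1 : ∀ k : K, p.1 * k ∈ T := fun k => mul_mem hp.1 (hK k.2)
  have hp2 : ∀ k : K, p.2 * k ∈ T := fun k => mul_mem hp.2 (hK k.2)
  have hcomm : ∀ k l : K, ⁅p.1 * k, p.2 * l⁆⁻¹ * 1 ∈ T := fun k l => by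
    rw [commutatorElement_def]
    exact mul_mem (inv_mem (mul_mem (mul_mem (mul_mem (hp1 k) (hp2 l)) (inv_mem (hp1 k)))
      (inv_mem (hp2 l)))) (one_mem T)
  rw [averagedCount_cons, ← Nat.card_prod]
  let := cosetAction (N := N) p.1 hN
  have hsmul : ∀ (h : K × N) (k : K),
      p.1 * ((h • k : K) : G) = h.1 * (p.1 * k) * (h.1 : G)⁻¹ * h.2 := fun h k =>
    mul_inv_cancel_left _ _
  refine card_mul_dvd_sum_of_card_stabilizer_mul_dvd (H := K × N) (fun h k => ?_) fun k => ?_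
  · have hxT : (h.1 : G) ∈ T := hK h.1.2
    have hxk : (h.1 : G) * (p.1 * k) * (h.1 : G)⁻¹ ∈ T :=
      mul_mem (mul_mem hxT (hp1 k)) (inv_mem hxT)
    rw [hsmul, ← sum_conj_coset (fun b => averagedCount K N L
      (⁅h.1 * (p.1 * k) * (h.1 : G)⁻¹ * h.2, b⁆⁻¹ * 1)) p.2 h.1.2 (inv_mem h.1.2)]
    refine Finset.sum_congr rfl fun l _ => ?_
    rw [averagedCount_commutator_mul_left hTN hT L hxk
      (mul_mem (mul_mem hxT (hp2 l)) (inv_mem hxT)) (one_mem T) (hN h.2.2),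
      ← averagedCount_conj hN L h.1.2 (⁅p.1 * (k : G), p.2 * (l : G)⁆⁻¹ * 1)]
    congr 1
    simp only [commutatorElement_def]
    group
  -- A stabilizer element (x, n) satisfies xax⁻¹n = a. Then ⁅a, bx⁆ and ⁅a, b⁆ agree modulo `N`, so
  -- b may be translated by x. If x = 1 then n = 1, so this action is free.
  · refine card_mul_dvd_sum_of_right_translation (MulAction.stabilizer (K × N) k) ?_ ?_ ?_
    · intro s hs h1
      have h2 := hsmul s k
      rw [MulAction.mem_stabilizer_iff.1 hs, h1] at h2
      exact Prod.ext h1 (Subtype.ext (by simpa using h2))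
    · intro s hs l
      have h2 := hsmul s k
      rw [MulAction.mem_stabilizer_iff.1 hs] at h2
      set a := p.1 * (k : G) with ha
      set b := p.2 * (l : G) with hb
      have h3 := hTN _ (mul_mem (hp1 k) (hp2 l)) _ s.2.2
      rw [← averagedCount_mul L (⁅a, b⁆⁻¹ * 1) (inv_mem h3)]
      congr 1
      have h4 : (s.1 : G) * a * (s.1 : G)⁻¹ = a * (s.2 : G)⁻¹ := eq_mul_inv_of_mul_eq h2.symm
      rw [Subgroup.coe_mul, ← mul_assoc, ← hb]
      calc ⁅a, b * s.1⁆⁻¹ * 1 = b * ((s.1 : G) * a * (s.1 : G)⁻¹) * b⁻¹ * a⁻¹ := by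
            simp only [commutatorElement_def]; group
        _ = _ := by rw [h4]; simp only [commutatorElement_def, ← ha]; group
    · intro l
      exact card_center_pow_dvd_averagedCount hK hTN hT L hL (hcomm k l)

end Average

/-- Take `N` to be the whole group of periods. Then the averaged count at 1 is |N| times the count,
and |N| cancels. -/
theorem card_mul_card_center_pow_dvd_commutatorCount [K.Normal] (p : G × G) (L : List (G × G)) :
    Nat.card K * Nat.card (Subgroup.center K) ^ (2 * L.length) ∣
      commutatorCount K (p :: L) 1 := by
  classical
  have hN : countPeriods K (p :: L) ≤ centerIn K := fun z hz => hz.1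
  have hfin : Finite (countPeriods K (p :: L)) :=
    Finite.of_injective (fun z => (⟨z, (mem_centerIn.1 (hN z.2)).1⟩ : K)) fun a b h =>
      Subtype.ext (congrArg (fun k : K => (k : G)) h)
  let := Fintype.ofFinite (countPeriods K (p :: L))
  have h := dvd_averagedCount_cons_one (N := countPeriods K (p :: L))
    (T := periodCentralizer K (p :: L)) hN
    (fun x hx z hz => by
      have := (mem_centerIn.1 (inv_mem hz)).2 x hx
      rw [this]
      simp)
    (fun h hh n hn => conj_mem_countPeriods hn hh) (fun h hh => hh) p L
    (fun q hq => mem_periodCentralizer_of_mem hq)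
  have h1 : averagedCount K (countPeriods K (p :: L)) (p :: L) 1 =
      Nat.card (countPeriods K (p :: L)) * commutatorCount K (p :: L) 1 := by
    have : ∀ n : countPeriods K (p :: L), commutatorCount K (p :: L) (1 * n) =
        commutatorCount K (p :: L) 1 := fun n => by rw [one_mul, ← mul_one (n : G), n.2.2]
    rw [averagedCount, Finset.sum_congr rfl fun n _ => this n]
    simp
  rw [h1, mul_comm (Nat.card K), mul_assoc] at h
  exact Nat.dvd_of_mul_dvd_mul_left Nat.card_pos h

theorem sum_prod_commutator_eq_commutatorCount {d : ℕ} (α β : Fin d → G) (u : G) :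
    Nat.card {f : Fin d → K × K //
      (List.ofFn fun i => ⁅α i * (f i).1, β i * (f i).2⁆).prod = u} =
      commutatorCount K (List.ofFn fun i => (α i, β i)) u := by
  classical
  rw [Nat.card_eq_fintype_card, Fintype.card_subtype, Finset.card_filter]
  induction d generalizing u with
  | zero => simp [commutatorCount, eq_comm]
  | succ d ih =>
    rw [← (Fin.consEquiv fun _ => K × K).sum_comp, Fintype.sum_prod_type, Fintype.sum_prod_type,
      List.ofFn_succ, commutatorCount]
    refine Finset.sum_congr rfl fun k _ => Finset.sum_congr rfl fun l _ => ?_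
    rw [← ih]
    refine Finset.sum_congr rfl fun f _ => ?_
    refine if_congr ?_ rfl rfl
    rw [eq_inv_mul_iff_mul_eq]
    simp [Fin.consEquiv, List.ofFn_succ]

end CommutatorCount

/-! ### Coverings from labels, and their monodromy -/

open Topology unitInterval

section TwistedCover

variable {X Y H : Type*} [TopologicalSpace X] [TopologicalSpace Y] [Group H]

/-- The product `X × H`, with a topology twisted by the maps `p : Y → X` and `Λ : Y → H`. -/
@[nolint unusedArguments]
def TwistedCover (_p : Y → X) (_Λ : Y → H) : Type _ := X × H

namespace TwistedCover

variable {p : Y → X} {Λ : Y → H}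

variable (p Λ) in
/-- The map `Y × H → TwistedCover p Λ` defining the topology. -/
def chart (y : Y × H) : TwistedCover p Λ := (p y.1, y.2 * Λ y.1)

instance : TopologicalSpace (TwistedCover p Λ) :=
  letI : TopologicalSpace H := ⊥
  TopologicalSpace.coinduced (chart p Λ) inferInstance

variable (p Λ) in
/-- The projection to the base. -/
def proj (e : TwistedCover p Λ) : X := e.1

instance : MulAction H (TwistedCover p Λ) where
  smul h e := (e.1, h * e.2)
  one_smul _ := Prod.ext rfl (one_mul _)
  mul_smul _ _ _ := Prod.ext rfl (mul_assoc _ _ _)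

theorem isOpen_iff {U : Set (TwistedCover p Λ)} :
    IsOpen U ↔ ∀ h : H, IsOpen {y | chart p Λ (y, h) ∈ U} := by
  let : TopologicalSpace H := ⊥
  have : DiscreteTopology H := ⟨rfl⟩
  change IsOpen (chart p Λ ⁻¹' U) ↔ _
  constructor
  · intro hU h
    exact hU.preimage (f := fun y => (y, h)) (by fun_prop)
  · intro hU
    rw [isOpen_prod_iff]
    intro y h hy
    exact ⟨_, {h}, hU h, isOpen_discrete _, hy, rfl, fun z hz => by
      obtain ⟨hz1, hz2⟩ := hz
      have : z.2 = h := hz2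
      subst this
      exact hz1⟩

theorem continuous_chart (h : H) : Continuous fun y => chart p Λ (y, h) :=
  ⟨fun _ hU => isOpen_iff.1 hU h⟩

/-- If `Λ` is locally compatible with the identifications made by `p`, then the twisted product
is a covering space of `X` with group `H`. -/
theorem isQuotientCoveringMap (hp : IsQuotientMap p)
    (hloc : ∀ x : X, ∃ B : Y → Set Y, (∀ c, p c = x → IsOpen (B c) ∧ c ∈ B c) ∧
      (∀ c c', p c = x → p c' = x → (B c ∩ B c').Nonempty → c = c') ∧
      ∀ c y y', p c = x → y ∈ B c → p y = p y' →
        ∃ c', p c' = x ∧ y' ∈ B c' ∧ (Λ c)⁻¹ * Λ y = (Λ c')⁻¹ * Λ y') :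
    IsQuotientCoveringMap (proj p Λ) H where
  toIsQuotientMap := by
    rw [isQuotientMap_iff]
    refine ⟨.of_isOpen_preimage_iff_isOpen fun U => ?_, fun x => ⟨((x, 1) : X × H), rfl⟩⟩
    rw [isOpen_iff, ← hp.isOpen_preimage]
    exact ⟨fun h => h 1, fun h _ => h⟩
  continuous_const_smul g := by
    refine ⟨fun U hU => isOpen_iff.2 fun h => ?_⟩
    have := isOpen_iff.1 hU (g * h)
    convert this using 1
    ext y
    change ((p y, g * (h * Λ y)) : X × H) ∈ U ↔ ((p y, g * h * Λ y) : X × H) ∈ U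
    rw [mul_assoc]
  apply_eq_iff_mem_orbit := by
    rintro ⟨x, g⟩ ⟨x', g'⟩
    constructor
    · rintro (h : x = x')
      exact ⟨g * g'⁻¹, Prod.ext h.symm (inv_mul_cancel_right g g')⟩
    · rintro ⟨h, hh⟩
      exact (congrArg Prod.fst hh).symm
  disjoint := by
    rintro ⟨x, h⟩
    obtain ⟨B, hB, hdisj, hcompat⟩ := hloc x
    -- The sheet through (x, h). The factor (Λ c)⁻¹ makes the pieces over the different points c of
    -- the fiber fit together.
    refine ⟨{e | ∃ c y, p c = x ∧ y ∈ B c ∧ e = ((p y, h * (Λ c)⁻¹ * Λ y) : X × H)}, ?_, ?_⟩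
    · refine IsOpen.mem_nhds (isOpen_iff.2 fun g => ?_) ?_
      · have : {y | chart p Λ (y, g) ∈ {e : TwistedCover p Λ | ∃ c y, p c = x ∧ y ∈ B c ∧
            e = ((p y, h * (Λ c)⁻¹ * Λ y) : X × H)}} =
            ⋃ c ∈ {c | p c = x ∧ g = h * (Λ c)⁻¹}, B c := by
          ext y
          simp only [Set.mem_ofPred_eq, Set.mem_iUnion, exists_prop]
          constructor
          · rintro ⟨c, z, hc, hz, he⟩
            have h1 : p y = p z := congrArg Prod.fst he
            have h2 : g * Λ y = h * (Λ c)⁻¹ * Λ z := congrArg Prod.snd he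
            obtain ⟨c', hc', hy, h3⟩ := hcompat c z y hc hz h1.symm
            rw [mul_assoc, h3, ← mul_assoc] at h2
            exact ⟨c', ⟨hc', mul_right_cancel h2⟩, hy⟩
          · rintro ⟨c, ⟨hc, rfl⟩, hy⟩
            exact ⟨c, y, hc, hy, rfl⟩
        rw [this]
        exact isOpen_biUnion fun c hc => (hB c hc.1).1
      · obtain ⟨c, hc⟩ := hp.surjective x
        exact ⟨c, c, hc, (hB c hc).2, Prod.ext hc.symm (by simp)⟩
    · rintro g ⟨_, ⟨e, ⟨c, y, hc, hy, rfl⟩, rfl⟩, c', y', hc', hy', he⟩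
      have h1 : p y = p y' := congrArg Prod.fst he
      have h2 : g * (h * (Λ c)⁻¹ * Λ y) = h * (Λ c')⁻¹ * Λ y' := congrArg Prod.snd he
      obtain ⟨c'', hc'', hy'', h3⟩ := hcompat c y y' hc hy h1
      obtain rfl := hdisj c' c'' hc' hc'' ⟨y', hy', hy''⟩
      rw [mul_assoc h, mul_assoc h, h3] at h2
      exact mul_eq_right.1 (mul_right_cancel ((mul_assoc g _ _).trans h2))

/-- The homomorphism to `H` defined by the monodromy of the twisted product. -/
theorem exists_hom (hc : IsQuotientCoveringMap (proj p Λ) H) (hp : Continuous p) {y₀ : Y}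
    (hΛ : Λ y₀ = 1) :
    ∃ f : FundamentalGroup X (p y₀) →* H, ∀ (y : Y) (h : p y = p y₀) (δ : Path y₀ y),
      f (FundamentalGroup.fromPath
        ((Path.Homotopic.Quotient.mk (δ.map hp)).cast rfl h.symm))⁻¹ = Λ y := by
  let e : proj p Λ ⁻¹' {p y₀} := ⟨chart p Λ (y₀, 1), rfl⟩
  let φ := hc.fundamentalGroupToMulOpposite e
  -- `φ` has values in the opposite group; inversion turns it into a homomorphism to `H`.
  refine ⟨⟨⟨fun γ => (φ γ).unop⁻¹, by rw [map_one]; simp⟩, fun γ δ => ?_⟩, fun y h δ => ?_⟩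
  · change (φ (γ * δ)).unop⁻¹ = (φ γ).unop⁻¹ * (φ δ).unop⁻¹
    rw [map_mul, MulOpposite.unop_mul, mul_inv_rev]
  · change (φ _).unop⁻¹ = Λ y
    rw [map_inv, MulOpposite.unop_inv, inv_inv]
    refine MulOpposite.op_injective ?_
    rw [MulOpposite.op_unop]
    refine hc.fundamentalGroupToMulOpposite_apply_eq_Iff.2 ?_
    have he : Λ y • e.1 = chart p Λ (y, 1) :=
      Prod.ext h.symm (show Λ y * (1 * Λ y₀) = 1 * Λ y by rw [hΛ]; simp)
    let e' : proj p Λ ⁻¹' {p y₀} := ⟨Λ y • e.1, rfl⟩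
    let Γ : Path e.1 e'.1 := (δ.map (continuous_chart (p := p) (Λ := Λ) 1)).cast rfl he
    have := hc.isCoveringMap.monodromy_eq_of_map_eq (ex := e) (ey := e')
      (γ := (Path.Homotopic.Quotient.mk (δ.map hp)).cast rfl h.symm)
      (.mk Γ) (congrArg Path.Homotopic.Quotient.mk (Path.ext (funext fun t => rfl)))
    exact (congrArg Subtype.val this).symm

end TwistedCover

end TwistedCover

/-! ### Generating the fundamental group of a quotient of a simply connected space -/

section Generation

/-- The identity path in the unit interval. -/
def unitPath : Path (0 : I) 1 where
  toFun := id
  source' := rfl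
  target' := rfl

theorem contractibleSpace_unitInterval : ContractibleSpace I :=
  (convex_Icc (0 : ℝ) 1).contractibleSpace ⟨0, by simp⟩

variable {X Y Z : Type*} [TopologicalSpace X] [TopologicalSpace Y] [TopologicalSpace Z] {x₀ : X}

/-- The element of the fundamental group at `x₀` obtained by closing up a path with the chosen
connecting paths `τ`, such that the holonomy is multiplicative. -/
noncomputable def holonomy (τ : ∀ x, Path.Homotopic.Quotient x₀ x) {x y : X}
    (γ : Path.Homotopic.Quotient x y) : FundamentalGroup X x₀ :=
  (FundamentalGroup.fromPath (((τ x).trans γ).trans (τ y).symm))⁻¹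

variable (τ : ∀ x, Path.Homotopic.Quotient x₀ x)

theorem holonomy_trans {x y z : X} (γ : Path.Homotopic.Quotient x y)
    (δ : Path.Homotopic.Quotient y z) :
    holonomy τ (γ.trans δ) = holonomy τ γ * holonomy τ δ := by
  unfold holonomy
  rw [← mul_inv_rev, FundamentalGroup.mul_def]
  congr 1
  change _ = Path.Homotopic.Quotient.trans _ _
  simp only [Path.Homotopic.Quotient.trans_assoc]
  rw [← Path.Homotopic.Quotient.trans_assoc (τ y).symm, Path.Homotopic.Quotient.symm_trans,
    Path.Homotopic.Quotient.refl_trans]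

theorem holonomy_refl (x : X) : holonomy τ (.refl x) = 1 := by
  have := holonomy_trans τ (.refl x) (.refl x)
  rw [Path.Homotopic.Quotient.refl_trans] at this
  exact left_eq_mul.1 this

theorem holonomy_congr {x y x' y' : X} (γ : Path x y) (γ' : Path x' y')
    (h : ∀ t, γ t = γ' t) :
    holonomy τ (.mk γ) = holonomy τ (.mk γ') := by
  obtain rfl : x = x' := by simpa using h 0
  obtain rfl : y = y' := by simpa using h 1
  congr 2
  ext t
  exact h t

section Along

variable [SimplyConnectedSpace Z]

/-- The holonomy of the image of any path from `a` to `b` in a simply connected space. -/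
noncomputable def holonomyAlong (f : C(Z, X)) (a b : Z) : FundamentalGroup X x₀ :=
  holonomy τ ((Path.Homotopic.Quotient.mk (PathConnectedSpace.somePath a b)).map f)

theorem holonomyAlong_eq (f : C(Z, X)) {a b : Z} (δ : Path a b) :
    holonomyAlong τ f a b = holonomy τ (.mk (δ.map f.continuous)) := by
  rw [Path.Homotopic.Quotient.mk_map, holonomyAlong]
  congr 2
  exact Subsingleton.elim _ _

theorem holonomyAlong_mul (f : C(Z, X)) (a b c : Z) :
    holonomyAlong τ f a b * holonomyAlong τ f b c = holonomyAlong τ f a c := by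
  rw [holonomyAlong_eq τ f ((PathConnectedSpace.somePath a b).trans
    (PathConnectedSpace.somePath b c)), Path.map_trans, Path.Homotopic.Quotient.mk_trans,
    holonomy_trans]
  rfl

theorem holonomyAlong_self (f : C(Z, X)) (a : Z) : holonomyAlong τ f a a = 1 := by
  rw [holonomyAlong_eq τ f (Path.refl a)]
  exact holonomy_refl τ (f a)

theorem holonomyAlong_eq_inv_mul (f : C(Z, X)) (a b c : Z) :
    holonomyAlong τ f b c = (holonomyAlong τ f a b)⁻¹ * holonomyAlong τ f a c := by
  rw [← holonomyAlong_mul τ f a b c, inv_mul_cancel_left]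

end Along

variable {τ}

theorem holonomy_eq_inv (hτ : τ x₀ = .refl x₀) {y : X} (γ : Path.Homotopic.Quotient x₀ y)
    (h : x₀ = y) :
    holonomy τ γ = (FundamentalGroup.fromPath (γ.cast rfl h))⁻¹ := by
  subst h
  rw [holonomy, hτ, Path.Homotopic.Quotient.refl_trans, Path.Homotopic.Quotient.cast_rfl_rfl]
  congr 2
  change Path.Homotopic.Quotient.trans _ (Path.Homotopic.Quotient.symm
    (.mk (Path.refl x₀))) = _
  rw [← Path.Homotopic.Quotient.mk_symm, Path.refl_symm, Path.Homotopic.Quotient.mk_refl,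
    Path.Homotopic.Quotient.trans_refl]

variable (τ)

/-- A path is in the subgroup `S` if this is so locally. -/
theorem holonomy_mem_of_local (S : Subgroup (FundamentalGroup X x₀)) {ι : Type*} (U : ι → Set X)
    (hU : ∀ i, IsOpen (U i)) (hcover : ∀ x, ∃ i, x ∈ U i)
    (hS : ∀ i {x y : X} (γ : Path x y), (∀ t, γ t ∈ U i) → holonomy τ (.mk γ) ∈ S)
    {x y : X} (γ : Path x y) : holonomy τ (.mk γ) ∈ S := by
  obtain ⟨t, ht0, htm, ⟨n, hn⟩, ht⟩ := exists_monotone_Icc_subset_open_cover_unitInterval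
    (c := fun i => γ ⁻¹' U i) (fun i => (hU i).preimage γ.continuous)
    (fun s _ => by simpa using hcover (γ s))
  have := contractibleSpace_unitInterval
  let g : C(I, X) := γ.toContinuousMap
  have h1 : ∀ m, holonomyAlong τ g 0 (t m) ∈ S := by
    intro m
    induction m with
    | zero => rw [ht0, holonomyAlong_self]; exact one_mem S
    | succ m ih =>
      rw [← holonomyAlong_mul τ g 0 (t m)]
      refine mul_mem ih ?_
      obtain ⟨i, hi⟩ := ht m
      let δ : Path (t m) (t (m + 1)) :=
        (unitPath.subpath (t m) (t (m + 1))).cast rfl rfl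
      have hδ : ∀ s, δ s ∈ Set.Icc (t m) (t (m + 1)) := by
        intro s
        have := Path.range_subpath_of_le unitPath
          (t m) (t (m + 1)) (htm (Nat.le_succ m))
        have h2 : δ s ∈ Set.range (unitPath.subpath
          (t m) (t (m + 1))) := ⟨s, rfl⟩
        rw [this] at h2
        obtain ⟨r, hr, hr'⟩ := h2
        rw [← hr']
        exact hr
      rw [holonomyAlong_eq τ g δ]
      exact hS i _ fun s => hi (hδ s)
  have h2 := h1 n
  rw [hn n le_rfl, holonomyAlong_eq τ g unitPath] at h2
  exact holonomy_congr τ (unitPath.map g.continuous) γ (fun s => rfl) ▸ h2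

variable {p : Y → X} [SimplyConnectedSpace Y]

/-- If an open set in a quotient of `Y` contracts to a point along the images of tracks in `Y`,
then the holonomy of a path in this set can be computed from the tracks of its endpoints. -/
theorem holonomy_eq_of_contraction (hp : IsQuotientMap p) {U : Set X} (hU : IsOpen U) {x₁ : X}
    (K : Y × I → Y) (hK : ContinuousOn K ((p ⁻¹' U) ×ˢ Set.univ))
    (hK0 : ∀ y, p y ∈ U → K (y, 0) = y) (hK1 : ∀ y, p y ∈ U → p (K (y, 1)) = x₁)
    (hKp : ∀ y y', p y ∈ U → p y = p y' → ∀ s, p (K (y, s)) = p (K (y', s)))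
    {x x' : X} (γ : Path x x') (hγ : ∀ t, γ t ∈ U) :
    ∃ y y' c c', p c = p c' ∧ holonomy τ (.mk γ) =
      holonomyAlong τ ⟨p, hp.continuous⟩ y c * holonomyAlong τ ⟨p, hp.continuous⟩ c' y' := by
  obtain ⟨y, rfl⟩ := hp.surjective x
  obtain ⟨y', rfl⟩ := hp.surjective x'
  have hy : p y ∈ U := by simpa using hγ 0
  have hy' : p y' ∈ U := by simpa using hγ 1
  refine ⟨y, y', K (y, 1), K (y', 1), (hK1 y hy).trans (hK1 y' hy').symm, ?_⟩
  have hr := hp.restrictPreimage_isOpen hU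
  choose ψ hψ using hr.surjective
  have hψ' : ∀ u : U, p (ψ u) = u := fun u => congrArg Subtype.val (hψ u)
  let F : U × I → X := fun v => p (K ((ψ v.1 : Y), v.2))
  have hFp : ∀ (z : Y) (hz : p z ∈ U) (s : I), F (⟨p z, hz⟩, s) = p (K (z, s)) := fun z hz s =>
    hKp _ _ (ψ _).2 (hψ' ⟨p z, hz⟩) s
  -- The product of the restricted quotient map with the interval is again a quotient map, so
  -- continuity is checked upstairs.
  have hF : Continuous F := by
    refine hr.continuous_lift_prod_left ?_
    have : (fun v : (p ⁻¹' U) × I => F (U.restrictPreimage p v.1, v.2)) =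
        fun v => p (K ((v.1 : Y), v.2)) := funext fun v => hFp v.1 v.1.2 v.2
    rw [this]
    refine hp.continuous.comp (hK.comp_continuous (by fun_prop) fun v => ⟨v.1.2, trivial⟩)
  let G : C(I × I, X) := ⟨fun v => F (⟨γ v.1, hγ v.1⟩, v.2), hF.comp (by fun_prop)⟩
  have := contractibleSpace_unitInterval
  have hcontr : ContractibleSpace (I × I) := inferInstance
  have hG0 : ∀ t, G (t, 0) = γ t := fun t => by
    change p (K _) = _
    rw [hK0 _ (ψ _).2, hψ']
  have hG1 : ∀ t, G (t, 1) = x₁ := fun t => hK1 _ (ψ _).2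
  have hGl : ∀ s, G (0, s) = p (K (y, s)) := fun s => by
    rw [← hFp y hy s]
    exact congrArg (fun u => F (u, s)) (Subtype.ext γ.source)
  have hGr : ∀ s, G (1, s) = p (K (y', s)) := fun s => by
    rw [← hFp y' hy' s]
    exact congrArg (fun u => F (u, s)) (Subtype.ext γ.target)
  have hKs : ∀ z, p z ∈ U → Continuous fun s : I => K (z, s) := fun z hz =>
    hK.comp_continuous (by fun_prop) fun s => ⟨hz, trivial⟩
  let track : ∀ z, p z ∈ U → Path z (K (z, 1)) := fun z hz =>
    ⟨⟨fun s => K (z, s), hKs z hz⟩, hK0 z hz, rfl⟩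
  let bot : Path ((0, 0) : I × I) (1, 0) := unitPath.map (f := fun t => (t, 0)) (by fun_prop)
  let top : Path ((0, 1) : I × I) (1, 1) := unitPath.map (f := fun t => (t, 1)) (by fun_prop)
  let left : Path ((0, 0) : I × I) (0, 1) := unitPath.map (f := fun t => (0, t)) (by fun_prop)
  let right : Path ((1, 0) : I × I) (1, 1) := unitPath.map (f := fun t => (1, t)) (by fun_prop)
  have h1 : holonomyAlong τ G (0, 0) (1, 0) = holonomy τ (.mk γ) := by
    rw [holonomyAlong_eq τ G bot]
    exact holonomy_congr τ _ _ hG0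
  have h2 : holonomyAlong τ G (0, 1) (1, 1) = 1 := by
    rw [holonomyAlong_eq τ G top, ← holonomy_refl τ x₁]
    exact holonomy_congr τ _ (Path.refl x₁) hG1
  have h3 : holonomyAlong τ G (0, 0) (0, 1) =
      holonomyAlong τ ⟨p, hp.continuous⟩ y (K (y, 1)) := by
    rw [holonomyAlong_eq τ G left, holonomyAlong_eq τ _ (track y hy)]
    exact holonomy_congr τ _ _ hGl
  have h4 : holonomyAlong τ G (1, 0) (1, 1) =
      holonomyAlong τ ⟨p, hp.continuous⟩ y' (K (y', 1)) := by
    rw [holonomyAlong_eq τ G right, holonomyAlong_eq τ _ (track y' hy')]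
    exact holonomy_congr τ _ _ hGr
  have h5 : holonomyAlong τ ⟨p, hp.continuous⟩ (K (y', 1)) y' =
      (holonomyAlong τ ⟨p, hp.continuous⟩ y' (K (y', 1)))⁻¹ := by
    rw [eq_inv_iff_mul_eq_one, holonomyAlong_mul, holonomyAlong_self]
  have h6 := holonomyAlong_mul τ G (0, 0) (1, 0) (1, 1)
  rw [← holonomyAlong_mul τ G (0, 0) (0, 1) (1, 1), h1, h2, h3, h4, mul_one] at h6
  rw [h5, eq_mul_inv_iff_mul_eq, h6]

/-- Generation of the fundamental group of a quotient of a simply connected space. -/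
theorem eq_top_of_locally_contractible (hp : IsQuotientMap p)
    (hloc : ∀ x : X, ∃ U : Set X, IsOpen U ∧ x ∈ U ∧ ∃ (x₁ : X) (K : Y × I → Y),
      ContinuousOn K ((p ⁻¹' U) ×ˢ Set.univ) ∧ (∀ y, p y ∈ U → K (y, 0) = y) ∧
      (∀ y, p y ∈ U → p (K (y, 1)) = x₁) ∧
      ∀ y y', p y ∈ U → p y = p y' → ∀ s, p (K (y, s)) = p (K (y', s)))
    (hτ : τ x₀ = .refl x₀) (y₀ : Y) (S : Subgroup (FundamentalGroup X x₀))
    (hS : ∀ y, holonomyAlong τ ⟨p, hp.continuous⟩ y₀ y ∈ S) : S = ⊤ := by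
  choose U hU hxU x₁ K hK hK0 hK1 hKp using hloc
  refine (Subgroup.eq_top_iff' S).2 fun g => ?_
  obtain ⟨γ, rfl⟩ := Path.Homotopic.Quotient.mk_surjective g
  have h := holonomy_mem_of_local τ S U hU (fun x => ⟨x, hxU x⟩) (fun i x y δ hδ => ?_) γ
  · rw [holonomy_eq_inv hτ _ rfl, Path.Homotopic.Quotient.cast_rfl_rfl] at h
    exact (inv_mem_iff (H := S)).1 h
  · obtain ⟨y, y', c, c', -, h⟩ := holonomy_eq_of_contraction τ hp (hU i) (K i) (hK i) (hK0 i)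
      (hK1 i) (hKp i) δ hδ
    rw [h, holonomyAlong_eq_inv_mul τ _ y₀ y c, holonomyAlong_eq_inv_mul τ _ y₀ c' y']
    exact mul_mem (mul_mem (inv_mem (hS _)) (hS _)) (mul_mem (inv_mem (hS _)) (hS _))

end Generation

/-! ### Fibers of the gluing and small balls around their points -/

section Polygon

variable {d : ℕ}

local notation "Disc" => Metric.closedBall (0 : ℂ) 1

theorem polygonPoint_add (d : ℕ) (s t : ℝ) :
    polygonPoint d (s + t) = polygonPoint d s * polygonPoint d t := by
  rw [polygonPoint, polygonPoint, polygonPoint, ← Complex.exp_add]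
  congr 1
  push_cast
  ring

theorem norm_polygonPoint (d : ℕ) (s : ℝ) : ‖polygonPoint d s‖ = 1 :=
  Complex.norm_exp_ofReal_mul_I _

theorem polygonPoint_neg (d : ℕ) (s : ℝ) :
    polygonPoint d (-s) = (starRingEnd ℂ) (polygonPoint d s) := by
  rw [polygonPoint, polygonPoint, ← Complex.exp_conj]
  congr 1
  simp only [map_mul, Complex.conj_ofReal, Complex.conj_I]
  push_cast
  ring

theorem polygonPoint_eq_iff (hd : 1 ≤ d) {s t : ℝ} :
    polygonPoint d s = polygonPoint d t ↔ ∃ n : ℤ, s = t + 4 * d * n := by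
  have hd' : (d : ℝ) ≠ 0 := by positivity
  have hpi := Real.pi_ne_zero
  rw [polygonPoint, polygonPoint, Complex.exp_eq_exp_iff_exists_int]
  refine exists_congr fun n => ?_
  have h1 : ((2 * Real.pi * t / (4 * (d : ℝ)) : ℝ) : ℂ) * Complex.I +
      n * (2 * Real.pi * Complex.I) =
      ((2 * Real.pi * (t + 4 * d * n) / (4 * (d : ℝ)) : ℝ) : ℂ) * Complex.I := by
    have : (d : ℂ) ≠ 0 := by exact_mod_cast hd'
    push_cast
    field_simp
  rw [h1, mul_left_inj' Complex.I_ne_zero, Complex.ofReal_inj]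
  constructor
  · intro h
    field_simp at h
    linarith
  · rintro h
    rw [h]

theorem exists_polygonPoint_eq (hd : 1 ≤ d) {z : ℂ} (hz : ‖z‖ = 1) :
    ∃ s : ℝ, z = polygonPoint d s := by
  have hd' : (d : ℝ) ≠ 0 := by positivity
  refine ⟨4 * d * z.arg / (2 * Real.pi), ?_⟩
  have h := Complex.norm_mul_exp_arg_mul_I z
  rw [hz, Complex.ofReal_one, one_mul] at h
  rw [polygonPoint, ← h]
  congr 3
  rw [h]
  field_simp

theorem norm_polygonPoint_reflect (d : ℕ) (r s t : ℝ) :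
    ‖polygonPoint d (r - s) - polygonPoint d (r - t)‖ = ‖polygonPoint d s - polygonPoint d t‖ := by
  rw [sub_eq_add_neg r s, sub_eq_add_neg r t, polygonPoint_add, polygonPoint_add, ← mul_sub,
    norm_mul, norm_polygonPoint, one_mul, polygonPoint_neg, polygonPoint_neg, ← map_sub,
    RCLike.norm_conj]

theorem continuous_polygonPoint (d : ℕ) : Continuous (polygonPoint d) := by
  unfold polygonPoint
  fun_prop

/-- The point with parameter `s` on the boundary circle, as a point of the disc. -/
noncomputable def boundaryPoint (d : ℕ) (s : ℝ) : Disc :=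
  ⟨polygonPoint d s, by simp [norm_polygonPoint]⟩

theorem continuous_boundaryPoint (d : ℕ) : Continuous (boundaryPoint d) :=
  (continuous_polygonPoint d).subtype_mk _

theorem boundaryPoint_eq_iff (hd : 1 ≤ d) {s t : ℝ} :
    boundaryPoint d s = boundaryPoint d t ↔ ∃ n : ℤ, s = t + 4 * d * n :=
  Subtype.ext_iff.trans (polygonPoint_eq_iff hd)

theorem dist_boundaryPoint_reflect (d : ℕ) (r s t : ℝ) :
    dist (boundaryPoint d (r - s)) (boundaryPoint d (r - t)) =
      dist (boundaryPoint d s) (boundaryPoint d t) := by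
  rw [Subtype.dist_eq, Subtype.dist_eq, dist_eq_norm, dist_eq_norm]
  exact norm_polygonPoint_reflect d r s t

theorem polygonGluing_iff {x y : Disc} :
    PolygonGluing d x y ↔ ∃ k < 4 * d, k % 4 < 2 ∧ ∃ t ∈ Set.Icc (0 : ℝ) 1,
      x = boundaryPoint d (k + t) ∧ y = boundaryPoint d (k + 3 - t) := by
  constructor
  · rintro ⟨j, hj, t, ht0, ht1, ⟨hx, hy⟩ | ⟨hx, hy⟩⟩
    · refine ⟨4 * j, by omega, by omega, t, ⟨ht0, ht1⟩, Subtype.ext ?_, Subtype.ext ?_⟩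
      · rw [hx]; simp [boundaryPoint]
      · rw [hy]; simp only [boundaryPoint]; congr 1; push_cast; ring
    · refine ⟨4 * j + 1, by omega, by omega, t, ⟨ht0, ht1⟩, Subtype.ext ?_, Subtype.ext ?_⟩
      · rw [hx]; simp [boundaryPoint]
      · rw [hy]; simp only [boundaryPoint]; congr 1; push_cast; ring
  · rintro ⟨k, hk, hk4, t, ⟨ht0, ht1⟩, hx, hy⟩
    refine ⟨k / 4, by omega, t, ht0, ht1, ?_⟩
    have h := Nat.div_add_mod k 4
    rcases (by omega : k % 4 = 0 ∨ k % 4 = 1) with h0 | h0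
    · left
      have h' : (k : ℝ) = 4 * ((k / 4 : ℕ) : ℝ) := by
        rw [h0] at h; exact_mod_cast h.symm
      rw [← h', hx, hy]
      refine ⟨rfl, ?_⟩
      simp only [boundaryPoint]; congr 1; ring
    · right
      have h' : (k : ℝ) = 4 * ((k / 4 : ℕ) : ℝ) + 1 := by
        rw [h0] at h; exact_mod_cast h.symm
      have h'' : 4 * ((k / 4 : ℕ) : ℝ) + 3 = k + 2 := by rw [h']; ring
      rw [← h', h'', hx, hy]
      refine ⟨rfl, ?_⟩
      simp only [boundaryPoint]; congr 1; ring

theorem boundaryPoint_gluing {k : ℕ} (hk : k < 4 * d) (hk4 : k % 4 < 2) {t : ℝ}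
    (ht : t ∈ Set.Icc (0 : ℝ) 1) :
    (Quot.mk _ (boundaryPoint d (k + t)) : PolygonSurface d) =
      Quot.mk _ (boundaryPoint d (k + 3 - t)) :=
  Quot.sound (polygonGluing_iff.2 ⟨k, hk, hk4, t, ht, rfl, rfl⟩)

theorem iff_of_mk_eq {Q : Disc → Prop} (hQ : ∀ x y, PolygonGluing d x y → (Q x ↔ Q y))
    {x y : Disc} (h : (Quot.mk _ x : PolygonSurface d) = Quot.mk _ y) : Q x ↔ Q y :=
  iff_of_eq (congrArg (Quot.lift Q fun a b hab => propext (hQ a b hab)) h)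

theorem eq_of_mk_eq_of_norm_lt {x y : Disc} (hx : ‖(x : ℂ)‖ < 1)
    (h : (Quot.mk _ x : PolygonSurface d) = Quot.mk _ y) : y = x := by
  refine (iff_of_mk_eq (Q := fun z => z = x) (fun a b hab => ?_) h).1 rfl
  obtain ⟨k, -, -, t, -, rfl, rfl⟩ := polygonGluing_iff.1 hab
  constructor
  · rintro rfl; simp [boundaryPoint, norm_polygonPoint] at hx
  · rintro rfl; simp [boundaryPoint, norm_polygonPoint] at hx

theorem norm_eq_one_of_mk_eq {x y : Disc} (hx : ‖(x : ℂ)‖ = 1)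
    (h : (Quot.mk _ x : PolygonSurface d) = Quot.mk _ y) : ‖(y : ℂ)‖ = 1 := by
  refine le_antisymm (mem_closedBall_zero_iff.1 y.2) (not_lt.1 fun hy => ?_)
  obtain rfl := eq_of_mk_eq_of_norm_lt hy h.symm
  exact hy.ne hx

/-- A gluing on side k reflects the boundary parameter s to 2k + 3 - s. A fiber therefore has
parameters in ±s + ℤ, which is finite modulo 4d. -/
theorem finite_fiber (hd : 1 ≤ d) (x : PolygonSurface d) :
    {c : Disc | Quot.mk _ c = x}.Finite := by
  obtain ⟨c, rfl⟩ := Quot.exists_rep x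
  have hc1 : ‖(c : ℂ)‖ ≤ 1 := mem_closedBall_zero_iff.1 c.2
  rcases hc1.lt_or_eq with hc | hc
  · exact (Set.finite_singleton c).subset fun y hy => eq_of_mk_eq_of_norm_lt hc hy.symm
  · obtain ⟨s, hs⟩ := exists_polygonPoint_eq hd hc
    have hs : c = boundaryPoint d s := Subtype.ext hs
    have hsub : {y : Disc | (Quot.mk _ y : PolygonSurface d) = Quot.mk _ c} ⊆
        (fun n : ℕ => boundaryPoint d (n + s)) '' ↑(Finset.range (4 * d)) ∪
        (fun n : ℕ => boundaryPoint d (n - s)) '' ↑(Finset.range (4 * d)) := by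
      intro y hy
      have h1 : ∃ n : ℤ, y = boundaryPoint d (n + s) ∨ y = boundaryPoint d (n - s) := by
        refine (iff_of_mk_eq (Q := fun z => ∃ n : ℤ, z = boundaryPoint d (n + s) ∨
          z = boundaryPoint d (n - s)) (fun a b hab => ?_) hy).2 ⟨0, by simp [hs]⟩
        obtain ⟨k, -, -, t, -, rfl, rfl⟩ := polygonGluing_iff.1 hab
        simp only [boundaryPoint_eq_iff hd]
        constructor
        · rintro ⟨n, ⟨m, h⟩ | ⟨m, h⟩⟩
          · exact ⟨2 * k + 3 - n - 4 * d * m, .inr ⟨0, by push_cast; linarith⟩⟩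
          · exact ⟨2 * k + 3 - n - 4 * d * m, .inl ⟨0, by push_cast; linarith⟩⟩
        · rintro ⟨n, ⟨m, h⟩ | ⟨m, h⟩⟩
          · exact ⟨2 * k + 3 - n - 4 * d * m, .inr ⟨0, by push_cast; linarith⟩⟩
          · exact ⟨2 * k + 3 - n - 4 * d * m, .inl ⟨0, by push_cast; linarith⟩⟩
      obtain ⟨n, h⟩ := h1
      have h2 : ∃ m : ℕ, m < 4 * d ∧ ∃ l : ℤ, (n : ℝ) = m + 4 * d * l := by
        have hpos : (0 : ℤ) < 4 * d := by omega
        refine ⟨(n % (4 * d)).toNat, ?_, n / (4 * d), ?_⟩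
        · have := Int.emod_lt_of_pos n hpos
          have := Int.emod_nonneg n hpos.ne'
          omega
        · have h3 : ((n % (4 * d)).toNat : ℤ) = n % (4 * d) :=
            Int.toNat_of_nonneg (Int.emod_nonneg n hpos.ne')
          have h4 := Int.emod_add_mul_ediv n (4 * d)
          have h5 : n = ((n % (4 * d)).toNat : ℤ) + 4 * d * (n / (4 * d)) := by rw [h3, h4]
          exact_mod_cast h5
      obtain ⟨m, hm, l, hl⟩ := h2
      rcases h with rfl | rfl
      · exact .inl ⟨m, by simpa using hm,
          (boundaryPoint_eq_iff hd).2 ⟨-l, by rw [hl]; push_cast; ring⟩⟩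
      · exact .inr ⟨m, by simpa using hm,
          (boundaryPoint_eq_iff hd).2 ⟨-l, by rw [hl]; push_cast; ring⟩⟩
    exact Set.Finite.subset (((Finset.finite_toSet _).image _).union
      ((Finset.finite_toSet _).image _)) hsub

/-- The radius `ε` is so small that balls around points of the fiber over `x` are disjoint and
only meet those sides of the polygon which contain their centers. -/
structure IsSmallRadius (d : ℕ) (x : PolygonSurface d) (ε : ℝ) : Prop where
  pos : 0 < ε
  le_one : ε ≤ 1
  side : ∀ c : Disc, Quot.mk _ c = x → ∀ k < 4 * d, ∀ u ∈ Set.Icc (0 : ℝ) 1,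
    dist (boundaryPoint d (k + u)) c < ε → ∃ v ∈ Set.Icc (0 : ℝ) 1, c = boundaryPoint d (k + v)
  disjoint : ∀ c c' : Disc, Quot.mk _ c = x → Quot.mk _ c' = x → c ≠ c' → 2 * ε ≤ dist c c'

theorem exists_isSmallRadius (hd : 1 ≤ d) (x : PolygonSurface d) : ∃ ε, IsSmallRadius d x ε := by
  have hfin := finite_fiber hd x
  have hlt : ∀ δ : ℝ, 0 < δ → ∀ᶠ ε in 𝓝[>] (0 : ℝ), ε < δ := fun δ hδ =>
    (eventually_lt_nhds hδ).filter_mono nhdsWithin_le_nhds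
  have h1 : ∀ᶠ ε in 𝓝[>] (0 : ℝ), ∀ c ∈ {c : Disc | Quot.mk _ c = x},
      ∀ k ∈ (Finset.range (4 * d) : Set ℕ), ∀ u ∈ Set.Icc (0 : ℝ) 1,
      dist (boundaryPoint d (k + u)) c < ε →
        ∃ v ∈ Set.Icc (0 : ℝ) 1, c = boundaryPoint d (k + v) := by
    rw [Filter.eventually_all_finite hfin]
    intro c _
    rw [Filter.eventually_all_finite (Finset.finite_toSet _)]
    intro k _
    by_cases hc : c ∈ (fun v : ℝ => boundaryPoint d (k + v)) '' Set.Icc 0 1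
    · obtain ⟨v, hv, rfl⟩ := hc
      exact Filter.Eventually.of_forall fun ε u _ _ => ⟨v, hv, rfl⟩
    · have hcl : IsClosed ((fun v : ℝ => boundaryPoint d (k + v)) '' Set.Icc 0 1) :=
        (isCompact_Icc.image ((continuous_boundaryPoint d).comp (by fun_prop))).isClosed
      obtain ⟨δ, hδ, hball⟩ := Metric.isOpen_iff.1 hcl.isOpen_compl c hc
      filter_upwards [hlt δ hδ] with ε hε u hu hdist
      exact absurd ⟨u, hu, rfl⟩ (hball (hdist.trans hε))
  have h2 : ∀ᶠ ε in 𝓝[>] (0 : ℝ), ∀ c ∈ {c : Disc | Quot.mk _ c = x},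
      ∀ c' ∈ {c : Disc | Quot.mk _ c = x}, c ≠ c' → 2 * ε ≤ dist c c' := by
    rw [Filter.eventually_all_finite hfin]
    intro c _
    rw [Filter.eventually_all_finite hfin]
    intro c' _
    by_cases hc : c = c'
    · exact Filter.Eventually.of_forall fun ε h => absurd hc h
    · filter_upwards [hlt (dist c c' / 2) (half_pos (dist_pos.2 hc))] with ε hε _
      linarith
  obtain ⟨ε, h1, h2, h3, h4⟩ := (h1.and (h2.and ((hlt 1 one_pos).and self_mem_nhdsWithin))).exists
  exact ⟨ε, h4, h3.le, fun c hc k hk => h1 c hc k (by simpa using hk),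
    fun c c' hc hc' => h2 c hc c' hc'⟩

/-- Two pairs of boundary points on the same side are glued by the same identification. -/
def PairGluing (d : ℕ) (v w : Disc × Disc) : Prop :=
  ∃ k < 4 * d, k % 4 < 2 ∧ ∃ u ∈ Set.Icc (0 : ℝ) 1, ∃ t ∈ Set.Icc (0 : ℝ) 1,
    v = (boundaryPoint d (k + u), boundaryPoint d (k + t)) ∧
    w = (boundaryPoint d (k + 3 - u), boundaryPoint d (k + 3 - t))

theorem PairGluing.dist_eq {v w : Disc × Disc} (h : PairGluing d v w) :
    dist v.2 v.1 = dist w.2 w.1 := by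
  obtain ⟨k, -, -, u, -, t, -, rfl, rfl⟩ := h
  rw [← dist_boundaryPoint_reflect d (2 * k + 3)]
  congr 2 <;> ring

theorem PairGluing.mk_fst_eq {v w : Disc × Disc} (h : PairGluing d v w) :
    (Quot.mk _ v.1 : PolygonSurface d) = Quot.mk _ w.1 := by
  obtain ⟨k, hk, hk4, u, hu, t, -, rfl, rfl⟩ := h
  exact boundaryPoint_gluing hk hk4 hu

/-- A center close to a point of a side lies on that side itself, so the gluing of this side moves
both together. -/
theorem IsSmallRadius.exists_pairGluing {x : PolygonSurface d} {ε : ℝ} (hε : IsSmallRadius d x ε)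
    {y z : Disc} (h : PolygonGluing d y z) :
    (∀ c, Quot.mk _ c = x → dist y c < ε → ∃ c', PairGluing d (c, y) (c', z)) ∧
    (∀ c, Quot.mk _ c = x → dist z c < ε → ∃ c', PairGluing d (c', y) (c, z)) := by
  obtain ⟨k, hk, hk4, t, ht, rfl, rfl⟩ := polygonGluing_iff.1 h
  constructor
  · intro c hc hdist
    obtain ⟨u, hu, rfl⟩ := hε.side c hc k hk t ht hdist
    exact ⟨_, k, hk, hk4, u, hu, t, ht, rfl, rfl⟩
  · intro c hc hdist
    have h1 : (k : ℝ) + 3 - t = ((k + 2 : ℕ) : ℝ) + (1 - t) := by push_cast; ring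
    rw [h1] at hdist
    obtain ⟨u, hu, rfl⟩ := hε.side c hc (k + 2) (by omega) (1 - t)
      ⟨by linarith [ht.2], by linarith [ht.1]⟩ hdist
    refine ⟨boundaryPoint d (k + (1 - u)), k, hk, hk4, 1 - u,
      ⟨by linarith [hu.2], by linarith [hu.1]⟩, t, ht, rfl, Prod.ext ?_ rfl⟩
    simp only
    congr 1
    push_cast
    ring

/-- Along a chain of gluings from `y` to `z` the center is carried along. The gluings are isometric
on the boundary, so the distance to the center stays below ε. -/
theorem IsSmallRadius.exists_eqvGen {x : PolygonSurface d} {ε : ℝ} (hε : IsSmallRadius d x ε)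
    {c y z : Disc} (hc : Quot.mk _ c = x) (hy : dist y c < ε)
    (h : (Quot.mk _ y : PolygonSurface d) = Quot.mk _ z) :
    ∃ c', Quot.mk _ c' = x ∧ dist z c' < ε ∧ Relation.EqvGen (PairGluing d) (c, y) (c', z) := by
  refine (iff_of_mk_eq (Q := fun z => ∃ c', Quot.mk _ c' = x ∧ dist z c' < ε ∧
    Relation.EqvGen (PairGluing d) (c, y) (c', z)) (fun a b hab => ?_) h).1
      ⟨c, hc, hy, .refl _⟩
  obtain ⟨h1, h2⟩ := hε.exists_pairGluing hab
  constructor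
  · rintro ⟨c', hc', hd', hr⟩
    obtain ⟨c'', hg⟩ := h1 c' hc' hd'
    exact ⟨c'', hg.mk_fst_eq.symm.trans hc', hg.dist_eq.symm.trans_lt hd',
      hr.trans _ _ _ (.rel _ _ hg)⟩
  · rintro ⟨c', hc', hd', hr⟩
    obtain ⟨c'', hg⟩ := h2 c' hc' hd'
    exact ⟨c'', hg.mk_fst_eq.trans hc', hg.dist_eq.trans_lt hd',
      hr.trans _ _ _ ((Relation.EqvGen.rel _ _ hg).symm _ _)⟩

theorem IsSmallRadius.eq_of_dist_lt {x : PolygonSurface d} {ε : ℝ} (hε : IsSmallRadius d x ε)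
    {c c' y : Disc} (hc : Quot.mk _ c = x) (hc' : Quot.mk _ c' = x) (h : dist y c < ε)
    (h' : dist y c' < ε) : c = c' := by
  by_contra hne
  have := hε.disjoint c c' hc hc' hne
  have := dist_triangle_left c c' y
  linarith

end Polygon

/-! ### Local contractions of the surface -/

section Contraction

variable {d : ℕ}

local notation "Disc" => Metric.closedBall (0 : ℂ) 1

/-- The contraction of a neighborhood of the boundary point `c` to `c`, linear in logarithmic
coordinates. -/
noncomputable def logContraction (c y : Disc) (s : I) : Disc :=
  ⟨c * Complex.exp ((1 - s : ℝ) * Complex.log (y * (starRingEnd ℂ) c)), by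
    have hc := mem_closedBall_zero_iff.1 c.2
    have hy := mem_closedBall_zero_iff.1 y.2
    rw [mem_closedBall_zero_iff, norm_mul, Complex.norm_exp, Complex.re_ofReal_mul,
      Complex.log_re]
    have h1 : ‖(y : ℂ) * (starRingEnd ℂ) c‖ ≤ 1 := by
      rw [norm_mul, RCLike.norm_conj]
      exact mul_le_one₀ hy (norm_nonneg _) hc
    have h2 : Real.log ‖(y : ℂ) * (starRingEnd ℂ) c‖ ≤ 0 := Real.log_nonpos (norm_nonneg _) h1
    refine mul_le_one₀ hc (Real.exp_nonneg _) (Real.exp_le_one_iff.2 ?_)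
    exact mul_nonpos_of_nonneg_of_nonpos (by linarith [s.2.2]) h2⟩

theorem mul_conj_eq_one {c : ℂ} (hc : ‖c‖ = 1) : c * (starRingEnd ℂ) c = 1 := by
  rw [Complex.mul_conj, Complex.normSq_eq_norm_sq, hc]
  simp

theorem mul_conj_mem_slitPlane {c y : ℂ} (hc : ‖c‖ = 1) (h : dist y c < 1) :
    y * (starRingEnd ℂ) c ∈ Complex.slitPlane := by
  have h1 : y * (starRingEnd ℂ) c = 1 + (y - c) * (starRingEnd ℂ) c := by
    rw [sub_mul, mul_conj_eq_one hc]; ring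
  rw [h1]
  refine Complex.mem_slitPlane_of_norm_lt_one ?_
  rwa [norm_mul, RCLike.norm_conj, hc, mul_one, ← dist_eq_norm]

theorem logContraction_zero {c y : Disc} (hc : ‖(c : ℂ)‖ = 1) (h : dist y c < 1) :
    logContraction c y 0 = y := by
  refine Subtype.ext ?_
  have h1 := Complex.slitPlane_ne_zero (mul_conj_mem_slitPlane hc h)
  simp only [logContraction, Set.Icc.coe_zero, sub_zero, Complex.ofReal_one, one_mul]
  rw [Complex.exp_log h1, mul_left_comm, mul_conj_eq_one hc, mul_one]

theorem logContraction_one (c y : Disc) : logContraction c y 1 = c :=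
  Subtype.ext (by simp [logContraction])

theorem continuousAt_logContraction {c y : Disc} (hc : ‖(c : ℂ)‖ = 1) (h : dist y c < 1) (s : I) :
    ContinuousAt (fun v : Disc × I => logContraction c v.1 v.2) (y, s) := by
  rw [IsInducing.subtypeVal.continuousAt_iff]
  have h1 : ContinuousAt (fun v : Disc × I => Complex.log ((v.1 : ℂ) * (starRingEnd ℂ) (c : ℂ)))
      (y, s) :=
    ContinuousAt.clog (Continuous.continuousAt (by fun_prop)) (mul_conj_mem_slitPlane hc h)
  have h2 : ContinuousAt (fun v : Disc × I => ((1 - v.2 : ℝ) : ℂ)) (y, s) :=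
    Continuous.continuousAt (by fun_prop)
  exact (h2.mul h1).cexp.const_mul _

theorem logContraction_boundaryPoint (hd : 1 ≤ d) {k u t : ℝ} (hu : u ∈ Set.Icc (0 : ℝ) 1)
    (ht : t ∈ Set.Icc (0 : ℝ) 1) (s : I) :
    logContraction (boundaryPoint d (k + u)) (boundaryPoint d (k + t)) s =
      boundaryPoint d (k + (u + (1 - s) * (t - u))) := by
  refine Subtype.ext ?_
  have hd' : (1 : ℝ) ≤ d := by exact_mod_cast hd
  have h1 : polygonPoint d (k + t) * (starRingEnd ℂ) (polygonPoint d (k + u)) =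
      polygonPoint d (t - u) := by
    rw [← polygonPoint_neg, ← polygonPoint_add]
    congr 1
    ring
  have habs : |t - u| ≤ 1 := abs_le.2 ⟨by linarith [hu.2, ht.1], by linarith [hu.1, ht.2]⟩
  -- A side spans the angle π/(2d) ≤ π/2, so the principal logarithm recovers the angle.
  have h2 : |2 * Real.pi * (t - u) / (4 * d)| ≤ Real.pi / 2 := by
    rw [abs_div, abs_mul, abs_of_pos Real.two_pi_pos, abs_of_pos (by positivity : (0:ℝ) < 4 * d),
      div_le_iff₀ (by positivity)]
    nlinarith [Real.pi_pos, abs_nonneg (t - u), mul_le_mul habs hd' zero_le_one zero_le_one,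
      mul_nonneg Real.pi_pos.le (sub_nonneg.2 habs), mul_nonneg Real.pi_pos.le (sub_nonneg.2 hd')]
  have h3 : Complex.log (polygonPoint d (t - u)) =
      ((2 * Real.pi * (t - u) / (4 * d) : ℝ) : ℂ) * Complex.I := by
    rw [polygonPoint, Complex.log_exp]
    · simp only [Complex.mul_im, Complex.ofReal_re, Complex.I_im, Complex.ofReal_im]
      have := (abs_le.1 h2).1
      linarith [Real.pi_pos]
    · simp only [Complex.mul_im, Complex.ofReal_re, Complex.I_im, Complex.ofReal_im]
      have := (abs_le.1 h2).2
      linarith [Real.pi_pos]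
  change polygonPoint d (k + u) * Complex.exp (((1 - s : ℝ) : ℂ) * Complex.log
    (polygonPoint d (k + t) * (starRingEnd ℂ) (polygonPoint d (k + u)))) =
    polygonPoint d (k + (u + (1 - s) * (t - u)))
  rw [h1, h3, ← add_assoc, polygonPoint_add d (k + u)]
  congr 1
  rw [polygonPoint]
  congr 1
  push_cast
  ring

/-- On a side the contraction is affine in the parameter, and the gluing is an affine reflection of
the parameter. -/
theorem PairGluing.mk_logContraction_eq (hd : 1 ≤ d) {v w : Disc × Disc} (h : PairGluing d v w)
    (s : I) : (Quot.mk _ (logContraction v.1 v.2 s) : PolygonSurface d) =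
      Quot.mk _ (logContraction w.1 w.2 s) := by
  obtain ⟨k, hk, hk4, u, hu, t, ht, rfl, rfl⟩ := h
  have h1 : (u + (1 - s) * (t - u) : ℝ) ∈ Set.Icc (0 : ℝ) 1 := by
    have := convex_Icc (0 : ℝ) 1 hu ht (a := (s : ℝ)) (b := 1 - (s : ℝ)) s.2.1 (sub_nonneg.2 s.2.2) (by ring)
    convert this using 1
    simp only [smul_eq_mul]
    ring
  have h2 : ∀ r : ℝ, (k : ℝ) + 3 - r = k + 2 + (1 - r) := fun r => by ring
  have hmem : ∀ r ∈ Set.Icc (0 : ℝ) 1, 1 - r ∈ Set.Icc (0 : ℝ) 1 := fun r hr =>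
    ⟨by linarith [hr.2], by linarith [hr.1]⟩
  simp only
  rw [logContraction_boundaryPoint hd hu ht, h2, h2,
    logContraction_boundaryPoint hd (hmem u hu) (hmem t ht), boundaryPoint_gluing hk hk4 h1]
  congr 2
  ring

theorem mk_logContraction_eq_of_eqvGen (hd : 1 ≤ d) {v w : Disc × Disc}
    (h : Relation.EqvGen (PairGluing d) v w) (s : I) :
    (Quot.mk _ (logContraction v.1 v.2 s) : PolygonSurface d) =
      Quot.mk _ (logContraction w.1 w.2 s) := by
  induction h with
  | rel v w h => exact h.mk_logContraction_eq hd s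
  | refl => rfl
  | symm _ _ _ ih => exact ih.symm
  | trans _ _ _ _ _ ih1 ih2 => exact ih1.trans ih2

/-- Every point of the surface has a neighborhood which contracts along images of tracks in the
disc. -/
theorem polygonSurface_locally_contractible (hd : 1 ≤ d) (x : PolygonSurface d) :
    ∃ U : Set (PolygonSurface d), IsOpen U ∧ x ∈ U ∧
      ∃ (x₁ : PolygonSurface d) (K : Disc × I → Disc),
      ContinuousOn K ((Quot.mk _ ⁻¹' U) ×ˢ Set.univ) ∧ (∀ y, Quot.mk _ y ∈ U → K (y, 0) = y) ∧
      (∀ y, Quot.mk _ y ∈ U → Quot.mk _ (K (y, 1)) = x₁) ∧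
      ∀ y y', Quot.mk _ y ∈ U → (Quot.mk _ y : PolygonSurface d) = Quot.mk _ y' →
        ∀ s, (Quot.mk _ (K (y, s)) : PolygonSurface d) = Quot.mk _ (K (y', s)) := by
  obtain ⟨c₀, rfl⟩ := Quot.exists_rep x
  have hc1 : ‖(c₀ : ℂ)‖ ≤ 1 := mem_closedBall_zero_iff.1 c₀.2
  rcases hc1.lt_or_eq with hc | hc
  · have hpre : ∀ y : Disc, (Quot.mk _ y : PolygonSurface d) ∈
        Quot.mk (PolygonGluing d) '' {y : Disc | ‖(y : ℂ)‖ < 1} → ‖(y : ℂ)‖ < 1 := by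
      rintro y ⟨z, hz, hzy⟩
      rwa [eq_of_mk_eq_of_norm_lt hz hzy]
    -- For an interior point the whole open disc serves, scaled to its center.
    refine ⟨Quot.mk _ '' {y : Disc | ‖(y : ℂ)‖ < 1}, ?_, ⟨c₀, hc, rfl⟩, Quot.mk _ ⟨0, by simp⟩,
      fun v => ⟨(1 - v.2 : ℝ) • (v.1 : ℂ), ?_⟩, ?_, fun y _ => ?_, fun y _ => ?_, ?_⟩
    · rw [← isQuotientMap_quot_mk.isOpen_preimage]
      convert isOpen_lt (f := fun y : Disc => ‖(y : ℂ)‖) (g := fun _ => 1) (by fun_prop)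
        (by fun_prop) using 1
      ext y
      exact ⟨hpre y, fun h => ⟨y, h, rfl⟩⟩
    · have h1 := mem_closedBall_zero_iff.1 v.1.2
      rw [mem_closedBall_zero_iff, norm_smul, Real.norm_eq_abs,
        abs_of_nonneg (by linarith [v.2.2.2])]
      exact mul_le_one₀ (by linarith [v.2.2.1]) (norm_nonneg _) h1
    · exact (Continuous.subtype_mk (by fun_prop) _).continuousOn
    · exact Subtype.ext (by simp)
    · congr 1
      exact Subtype.ext (by simp)
    · intro y y' hy h s
      rw [eq_of_mk_eq_of_norm_lt (hpre y hy) h]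
  · obtain ⟨ε, hε⟩ := exists_isSmallRadius hd (Quot.mk (PolygonGluing d) c₀)
    have hF : ∀ c : Disc, Quot.mk _ c = Quot.mk (PolygonGluing d) c₀ → ‖(c : ℂ)‖ = 1 :=
      fun c h => norm_eq_one_of_mk_eq hc h.symm
    let V : Set Disc := {y | ∃ c, Quot.mk _ c = Quot.mk (PolygonGluing d) c₀ ∧ dist y c < ε}
    have hpre : ∀ y : Disc, (Quot.mk _ y : PolygonSurface d) ∈ Quot.mk (PolygonGluing d) '' V →
        y ∈ V := by
      rintro y ⟨z, ⟨c, hc, hz⟩, hzy⟩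
      obtain ⟨c', hc', hy, -⟩ := hε.exists_eqvGen hc hz hzy
      exact ⟨c', hc', hy⟩
    have hVo : IsOpen V := by
      have : V = ⋃ c ∈ {c | Quot.mk _ c = Quot.mk (PolygonGluing d) c₀}, Metric.ball c ε := by
        ext y; simp [V]
      rw [this]
      exact isOpen_biUnion fun _ _ => Metric.isOpen_ball
    have hpreV : Quot.mk (PolygonGluing d) ⁻¹' (Quot.mk (PolygonGluing d) '' V) = V :=
      Set.ext fun y => ⟨hpre y, fun h => ⟨y, h, rfl⟩⟩
    classical
    -- The chosen center is unique, because the ε-balls around the fiber are disjoint.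
    let K : Disc × I → Disc := fun v =>
      if h : v.1 ∈ V then logContraction h.choose v.1 v.2 else v.1
    have hK : ∀ (y c : Disc) (s : I), Quot.mk _ c = Quot.mk (PolygonGluing d) c₀ → dist y c < ε →
        K (y, s) = logContraction c y s := by
      intro y c s hc hy
      have h : y ∈ V := ⟨c, hc, hy⟩
      have h' : h.choose = c := hε.eq_of_dist_lt h.choose_spec.1 hc h.choose_spec.2 hy
      simp only [K, dif_pos h, h']
    refine ⟨Quot.mk _ '' V, ?_, ⟨c₀, ⟨c₀, rfl, by simpa using hε.pos⟩, rfl⟩, Quot.mk _ c₀, K,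
      ?_, fun y hy => ?_, fun y hy => ?_, ?_⟩
    · rw [← isQuotientMap_quot_mk.isOpen_preimage, hpreV]
      exact hVo
    · rintro ⟨y, s⟩ ⟨hy, -⟩
      obtain ⟨c, hc, hyc⟩ := hpre y hy
      refine ContinuousAt.continuousWithinAt ?_
      refine (continuousAt_logContraction (hF c hc) (hyc.trans_le hε.le_one) s).congr ?_
      have : Metric.ball c ε ×ˢ (Set.univ : Set I) ∈ 𝓝 (y, s) :=
        prod_mem_nhds (Metric.isOpen_ball.mem_nhds hyc) Filter.univ_mem
      filter_upwards [this] with v hv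
      exact (hK v.1 c v.2 hc hv.1).symm
    · obtain ⟨c, hc, hyc⟩ := hpre y hy
      rw [hK y c 0 hc hyc, logContraction_zero (hF c hc) (hyc.trans_le hε.le_one)]
    · obtain ⟨c, hc, hyc⟩ := hpre y hy
      rw [hK y c 1 hc hyc, logContraction_one, hc]
    · intro y y' hy h s
      obtain ⟨c, hc, hyc⟩ := hpre y hy
      obtain ⟨c', hc', hy', hr⟩ := hε.exists_eqvGen hc hyc h
      rw [hK y c s hc hyc, hK y' c' s hc' hy']
      exact mk_logContraction_eq_of_eqvGen hd hr s

end Contraction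

/-! ### The covering defined by labels of the vertices -/

section Label

variable {d : ℕ} {H : Type*} [Group H]

local notation "Disc" => Metric.closedBall (0 : ℂ) 1

/-- The vertex whose label is used at the parameter `s` of the boundary. -/
noncomputable def labelIndex (s : ℝ) : ℕ := if ⌊s⌋₊ % 4 < 2 then ⌊s⌋₊ else ⌈s⌉₊

open Classical in
/-- The labelling of the disc determined by labels of the vertices of the polygon. -/
noncomputable def boundaryLabel (d : ℕ) (M : ℕ → H) (x : Disc) : H :=
  if h : ∃ s ∈ Set.Ico (0 : ℝ) (4 * d), x = boundaryPoint d s then M (labelIndex h.choose) else 1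

theorem labelIndex_natCast (k : ℕ) : labelIndex k = k := by simp [labelIndex]

theorem boundaryLabel_boundaryPoint (hd : 1 ≤ d) {M : ℕ → H} (hM : M (4 * d) = M 0) {s : ℝ}
    (hs : s ∈ Set.Icc (0 : ℝ) (4 * d)) :
    boundaryLabel d M (boundaryPoint d s) = M (labelIndex s) := by
  have hd' : (1 : ℝ) ≤ d := by exact_mod_cast hd
  have key : ∀ r ∈ Set.Ico (0 : ℝ) (4 * d), boundaryPoint d s = boundaryPoint d r →
      boundaryLabel d M (boundaryPoint d s) = M (labelIndex r) := by
    intro r hr hsr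
    have h : ∃ s' ∈ Set.Ico (0 : ℝ) (4 * d), boundaryPoint d s = boundaryPoint d s' := ⟨r, hr, hsr⟩
    have h1 := h.choose_spec
    have h2 : h.choose = r := by
      obtain ⟨n, hn⟩ := (boundaryPoint_eq_iff hd).1 (h1.2.symm.trans hsr)
      have h3 : n = 0 := by
        have h4 : (n : ℝ) < 1 := by
          by_contra! hlt
          nlinarith [h1.1.2, hr.1]
        have h5 : (-1 : ℝ) < n := by
          by_contra! hlt
          nlinarith [h1.1.1, hr.2]
        have h4' : n < 1 := by exact_mod_cast h4
        have h5' : -1 < n := by exact_mod_cast h5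
        omega
      rw [hn, h3]
      simp
    rw [boundaryLabel, dif_pos h, h2]
  rcases hs.2.lt_or_eq with hlt | heq
  · exact key s ⟨hs.1, hlt⟩ rfl
  · have h1 := key 0 ⟨le_rfl, by positivity⟩ ((boundaryPoint_eq_iff hd).2 ⟨1, by simp [heq]⟩)
    have h2 : labelIndex s = 4 * d := by
      rw [heq]
      exact_mod_cast labelIndex_natCast (4 * d)
    rw [h1, h2, hM]
    exact congrArg M (by exact_mod_cast labelIndex_natCast 0)

variable {M : ℕ → H} (hM : M (4 * d) = M 0)
  (hrel : ∀ k < 4 * d, k % 4 < 2 → M (k + 1) * (M (k + 2))⁻¹ = M k * (M (k + 3))⁻¹)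

include hM in
theorem boundaryLabel_vertex (hd : 1 ≤ d) {k : ℕ} (hk : k ≤ 4 * d) :
    boundaryLabel d M (boundaryPoint d k) = M k := by
  rw [boundaryLabel_boundaryPoint hd hM ⟨by positivity, by exact_mod_cast hk⟩, labelIndex_natCast]

-- For t < 1 the labels used on the two glued sides are those of the vertices k and k + 3. At t = 1
-- they are those of k + 1 and k + 2, and `hrel` makes the quotients agree.
include hM hrel in
theorem boundaryLabel_mul_inv (hd : 1 ≤ d) {k : ℕ} (hk : k < 4 * d) (hk4 : k % 4 < 2) {t : ℝ}
    (ht : t ∈ Set.Icc (0 : ℝ) 1) :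
    boundaryLabel d M (boundaryPoint d (k + t)) *
      (boundaryLabel d M (boundaryPoint d (k + 3 - t)))⁻¹ = M k * (M (k + 3))⁻¹ := by
  have hk3 : k + 3 ≤ 4 * d := by omega
  rcases ht.2.lt_or_eq with hlt | rfl
  · have hk3' : (k : ℝ) + 3 ≤ 4 * d := by exact_mod_cast hk3
    have hk0 : (0 : ℝ) ≤ k := by positivity
    have h1 : labelIndex (k + t) = k := by
      have : ⌊(k : ℝ) + t⌋₊ = k := (Nat.floor_eq_iff (by linarith [ht.1])).2
        ⟨by linarith [ht.1], by linarith⟩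
      rw [labelIndex, this, if_pos hk4]
    have h2 : labelIndex (k + 3 - t) = k + 3 := by
      rcases ht.1.eq_or_lt with rfl | hpos
      · rw [sub_zero]
        exact_mod_cast labelIndex_natCast (k + 3)
      · have : ⌊(k : ℝ) + 3 - t⌋₊ = k + 2 := (Nat.floor_eq_iff (by linarith)).2
          ⟨by push_cast; linarith, by push_cast; linarith⟩
        rw [labelIndex, this, if_neg (by omega)]
        exact (Nat.ceil_eq_iff (by omega)).2 ⟨by push_cast [Nat.add_sub_assoc]; linarith,
          by push_cast; linarith⟩
    rw [boundaryLabel_boundaryPoint hd hM ⟨by linarith [ht.1], by linarith⟩,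
      boundaryLabel_boundaryPoint hd hM ⟨by linarith [ht.1], by linarith [ht.1]⟩, h1, h2]
  · have h1 : (k : ℝ) + 1 = ((k + 1 : ℕ) : ℝ) := by push_cast; ring
    have h2 : (k : ℝ) + 3 - 1 = ((k + 2 : ℕ) : ℝ) := by push_cast; ring
    rw [h1, h2, boundaryLabel_vertex hM hd (by omega), boundaryLabel_vertex hM hd (by omega),
      hrel k hk hk4]

include hM hrel in
theorem boundaryLabel_inv_mul_eq_of_eqvGen (hd : 1 ≤ d) {v w : Disc × Disc}
    (h : Relation.EqvGen (PairGluing d) v w) :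
    (boundaryLabel d M v.1)⁻¹ * boundaryLabel d M v.2 =
      (boundaryLabel d M w.1)⁻¹ * boundaryLabel d M w.2 := by
  induction h with
  | rel v w h =>
    obtain ⟨k, hk, hk4, u, hu, t, ht, rfl, rfl⟩ := h
    have h1 := mul_inv_eq_iff_eq_mul.1 (boundaryLabel_mul_inv hM hrel hd hk hk4 hu)
    have h2 := mul_inv_eq_iff_eq_mul.1 (boundaryLabel_mul_inv hM hrel hd hk hk4 ht)
    simp only [h1, h2]
    group
  | refl => rfl
  | symm _ _ _ ih => exact ih.symm
  | trans _ _ _ _ _ ih1 ih2 => exact ih1.trans ih2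

include hM hrel in
theorem isQuotientCoveringMap_boundaryLabel (hd : 1 ≤ d) :
    IsQuotientCoveringMap (TwistedCover.proj (Quot.mk (PolygonGluing d)) (boundaryLabel d M)) H := by
  refine TwistedCover.isQuotientCoveringMap isQuotientMap_quot_mk fun x => ?_
  obtain ⟨ε, hε⟩ := exists_isSmallRadius hd x
  refine ⟨fun c => Metric.ball c ε, fun c _ => ⟨Metric.isOpen_ball, Metric.mem_ball_self hε.pos⟩,
    ?_, ?_⟩
  · rintro c c' hc hc' ⟨y, hy, hy'⟩
    exact hε.eq_of_dist_lt hc hc' hy hy'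
  · intro c y y' hc hy h
    obtain ⟨c', hc', hy', hr⟩ := hε.exists_eqvGen hc hy h
    exact ⟨c', hc', hy', boundaryLabel_inv_mul_eq_of_eqvGen hM hrel hd hr⟩

end Label

universe u

/-! ### Standard generators and the equation for lifts -/

section Basis

open scoped commutatorElement

/-- The elements `a i`, `b i` are standard generators of a surface group: they generate the group
and satisfy only the relation `∏ ⁅a i, b i⁆ = 1`. -/
structure IsSurfaceBasis {π : Type*} [Group π] {d : ℕ} (a b : Fin d → π) : Prop where
  closure_eq_top : Subgroup.closure (Set.range a ∪ Set.range b) = ⊤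
  prod_commutator : (List.ofFn fun i => ⁅a i, b i⁆).prod = 1
  exists_hom : ∀ (H : Type u) [Group H] (a' b' : Fin d → H),
    (List.ofFn fun i => ⁅a' i, b' i⁆).prod = 1 →
      ∃ f : π →* H, (∀ i, f (a i) = a' i) ∧ ∀ i, f (b i) = b' i

theorem map_prod_commutator {G H : Type*} [Group G] [Group H] {d : ℕ} (f : G →* H)
    (a b : Fin d → G) :
    f (List.ofFn fun i => ⁅a i, b i⁆).prod = (List.ofFn fun i => ⁅f (a i), f (b i)⁆).prod := by
  rw [map_list_prod, List.map_ofFn]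
  congr 2
  funext i
  exact map_commutatorElement f _ _

theorem IsSurfaceBasis.map {π π' : Type*} [Group π] [Group π'] {d : ℕ} {a b : Fin d → π}
    (h : IsSurfaceBasis.{u} a b) (e : π ≃* π') : IsSurfaceBasis.{u} (e ∘ a) (e ∘ b) where
  closure_eq_top := by
    rw [Set.range_comp, Set.range_comp, ← Set.image_union]
    have := (MonoidHom.map_closure e.toMonoidHom (Set.range a ∪ Set.range b)).symm
    refine this.trans ?_
    rw [h.closure_eq_top]
    exact Subgroup.map_top_of_surjective _ e.surjective
  prod_commutator := by
    have := map_prod_commutator e.toMonoidHom a b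
    rw [h.prod_commutator, map_one] at this
    exact this.symm
  exists_hom H _ a' b' hab := by
    obtain ⟨f, hf, hf'⟩ := h.exists_hom H a' b' hab
    exact ⟨f.comp e.symm.toMonoidHom, fun i => by simp [hf], fun i => by simp [hf']⟩

theorem IsSurfaceBasis.hom_ext {π H : Type*} [Group π] [Group H] {d : ℕ} {a b : Fin d → π}
    (h : IsSurfaceBasis a b) {f f' : π →* H} (ha : ∀ i, f (a i) = f' (a i))
    (hb : ∀ i, f (b i) = f' (b i)) : f = f' := by
  refine MonoidHom.eq_of_eqOn_dense h.closure_eq_top ?_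
  rintro _ (⟨i, rfl⟩ | ⟨i, rfl⟩)
  exacts [ha i, hb i]

/-- Lifts of a homomorphism correspond to solutions of the surface relation in cosets. -/
noncomputable def IsSurfaceBasis.homLiftsEquiv {π G : Type*} {G' : Type*} [Group π] [Group G]
    [Group G'] {d : ℕ} {a b : Fin d → π} (h : IsSurfaceBasis a b) (q : G' →* G) (g : π →* G)
    {α β : Fin d → G'} (hα : ∀ i, q (α i) = g (a i)) (hβ : ∀ i, q (β i) = g (b i)) :
    homLifts q g ≃ {f : Fin d → q.ker × q.ker //
      (List.ofFn fun i => ⁅α i * (f i).1, β i * (f i).2⁆).prod = 1} := by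
  have hmem : ∀ (g' : homLifts q g) (x : π), q (g'.1 x) = g x := fun g' x => DFunLike.congr_fun g'.2 x
  refine Equiv.ofBijective (fun g' => ⟨fun i =>
    (⟨(α i)⁻¹ * g'.1 (a i), by simp [MonoidHom.mem_ker, hα, hmem]⟩,
      ⟨(β i)⁻¹ * g'.1 (b i), by simp [MonoidHom.mem_ker, hβ, hmem]⟩), ?_⟩) ⟨?_, ?_⟩
  · simp only [mul_inv_cancel_left]
    rw [← map_prod_commutator, h.prod_commutator, map_one]
  · intro g₁ g₂ h12
    have h1 := fun i => congrFun (congrArg Subtype.val h12) i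
    simp only [Prod.mk.injEq, Subtype.mk.injEq, mul_right_inj] at h1
    exact Subtype.ext (h.hom_ext (fun i => (h1 i).1) fun i => (h1 i).2)
  · rintro ⟨f, hf⟩
    obtain ⟨g', ha, hb⟩ := h.exists_hom G' _ _ hf
    refine ⟨⟨g', h.hom_ext (fun i => ?_) fun i => ?_⟩, Subtype.ext (funext fun i => ?_)⟩
    · rw [MonoidHom.comp_apply, ha, map_mul, hα, (f i).1.2, mul_one]
    · rw [MonoidHom.comp_apply, hb, map_mul, hβ, (f i).2.2, mul_one]
    · refine Prod.ext (Subtype.ext ?_) (Subtype.ext ?_)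
      · simp [ha]
      · simp [hb]

end Basis

/-! ### Vertex labels read off from the surface word -/

section VertexLabels

open scoped commutatorElement

theorem prod_ofFn_eq_of_succ {H : Type*} [Group H] {d : ℕ} (c : Fin d → H) (N : ℕ → H)
    (h0 : N 0 = 1) (hN : ∀ j : Fin d, N (j + 1) = N j * c j) : (List.ofFn c).prod = N d := by
  induction d with
  | zero => simp [h0]
  | succ d ih =>
    rw [List.ofFn_succ', List.concat_eq_append, List.prod_append,
      ih _ fun j => by simpa using hN j.castSucc]
    simpa using (hN (Fin.last d)).symm

variable {H : Type*} [Group H] {d : ℕ}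

/-- The letters of the word `a₁ b₁ a₁⁻¹ b₁⁻¹ ⋯`. -/
def surfaceLetter (a b : Fin d → H) (k : ℕ) : H :=
  if h : k / 4 < d then
    if k % 4 = 0 then a ⟨k / 4, h⟩ else if k % 4 = 1 then b ⟨k / 4, h⟩
    else if k % 4 = 2 then (a ⟨k / 4, h⟩)⁻¹ else (b ⟨k / 4, h⟩)⁻¹
  else 1

/-- The products of initial segments of the word `a₁ b₁ a₁⁻¹ b₁⁻¹ ⋯`. -/
def surfacePrefix (a b : Fin d → H) (k : ℕ) : H := ((List.range k).map (surfaceLetter a b)).prod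

theorem surfacePrefix_succ (a b : Fin d → H) (k : ℕ) :
    surfacePrefix a b (k + 1) = surfacePrefix a b k * surfaceLetter a b k :=
  List.prod_range_succ _ _

theorem surfaceLetter_add_two (a b : Fin d → H) {k : ℕ} (hk : k % 4 < 2) :
    surfaceLetter a b (k + 2) = (surfaceLetter a b k)⁻¹ := by
  have h1 : (k + 2) / 4 = k / 4 := by omega
  have h2 : (k + 2) % 4 = k % 4 + 2 := by omega
  rcases (by omega : k % 4 = 0 ∨ k % 4 = 1) with h | h <;>
    by_cases hd : k / 4 < d <;> simp [surfaceLetter, h1, h2, h, hd]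

theorem surfaceLetter_four_mul (a b : Fin d → H) (j : Fin d) :
    surfaceLetter a b (4 * j) = a j := by
  simp [surfaceLetter]

theorem surfaceLetter_four_mul_add_one (a b : Fin d → H) (j : Fin d) :
    surfaceLetter a b (4 * j + 1) = b j := by
  have h1 : (4 * (j : ℕ) + 1) / 4 = j := by omega
  have h2 : (4 * (j : ℕ) + 1) % 4 = 1 := by omega
  simp [surfaceLetter, h1, h2]

theorem surfacePrefix_relation (a b : Fin d → H) {k : ℕ} (hk : k % 4 < 2) :
    surfacePrefix a b (k + 1) * (surfacePrefix a b (k + 2))⁻¹ =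
      surfacePrefix a b k * (surfacePrefix a b (k + 3))⁻¹ := by
  rw [surfacePrefix_succ a b (k + 2), surfacePrefix_succ a b (k + 1), surfacePrefix_succ a b k,
    surfaceLetter_add_two a b hk]
  group

theorem surfacePrefix_four_mul (a b : Fin d → H) :
    surfacePrefix a b (4 * d) = (List.ofFn fun i => ⁅a i, b i⁆).prod := by
  refine (prod_ofFn_eq_of_succ _ (fun j => surfacePrefix a b (4 * j)) rfl fun j => ?_).symm
  have h : 4 * ((j : ℕ) + 1) = 4 * j + 1 + 1 + 1 + 1 := by ring
  rw [h, surfacePrefix_succ, surfacePrefix_succ, surfacePrefix_succ, surfacePrefix_succ,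
    surfaceLetter_add_two a b (k := 4 * j + 1) (by omega),
    surfaceLetter_add_two a b (k := 4 * j) (by omega), surfaceLetter_four_mul,
    surfaceLetter_four_mul_add_one, commutatorElement_def]
  group

end VertexLabels

/-! ### Connecting paths that come from the disc -/

section ConnectingPaths

variable {X Y : Type*} [TopologicalSpace X] [TopologicalSpace Y] [SimplyConnectedSpace Y]

/-- Each τ x is the image of a path from `y₀` to a point of the fiber over x, so closing up that
image gives the trivial loop. Over the base point the constant path is taken. -/
theorem exists_connecting_paths (p : C(Y, X)) (hp : Function.Surjective p) (y₀ : Y) :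
    ∃ τ : ∀ x, Path.Homotopic.Quotient (p y₀) x, τ (p y₀) = .refl (p y₀) ∧
      ∀ x, ∃ y, p y = x ∧ holonomyAlong τ p y₀ y = 1 := by
  have h : ∀ x, ∃ (γ : Path.Homotopic.Quotient (p y₀) x),
      (∃ (y : Y) (h : p y = x) (δ : Path y₀ y),
        γ = (Path.Homotopic.Quotient.mk (δ.map p.continuous)).cast rfl h.symm) ∧
      ∀ h : x = p y₀, γ = (Path.Homotopic.Quotient.refl (p y₀)).cast rfl h := by
    intro x
    by_cases hx : x = p y₀
    · subst hx
      exact ⟨.refl _, ⟨y₀, rfl, .refl y₀, rfl⟩, fun _ => rfl⟩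
    · obtain ⟨y, rfl⟩ := hp x
      exact ⟨_, ⟨y, rfl, PathConnectedSpace.somePath y₀ y, rfl⟩, fun h => absurd h hx⟩
  choose τ h1 h2 using h
  have h0 : τ (p y₀) = .refl (p y₀) := h2 _ rfl
  refine ⟨τ, h0, fun x => ?_⟩
  obtain ⟨y, rfl, δ, hδ⟩ := h1 x
  refine ⟨y, rfl, ?_⟩
  rw [holonomyAlong_eq τ p δ, holonomy, h0, hδ, Path.Homotopic.Quotient.cast_rfl_rfl,
    Path.Homotopic.Quotient.refl_trans, Path.Homotopic.Quotient.trans_symm]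
  exact inv_one

end ConnectingPaths

/-! ### The standard presentation for the polygon surface -/

section Presentation

theorem eq_mul_inv_of_mul_inv_eq {G : Type*} [Group G] {x y z w : G}
    (h : x * y⁻¹ = w * z⁻¹) : z = y * (w⁻¹ * x)⁻¹ := by
  rw [eq_mul_inv_iff_mul_eq] at h
  rw [← h]
  group

variable {d : ℕ}

local notation "Disc" => Metric.closedBall (0 : ℂ) 1

theorem contractibleSpace_disc : ContractibleSpace Disc :=
  (convex_closedBall (0 : ℂ) 1).contractibleSpace ⟨0, by simp⟩

/-- Both ends of glued sides are identified: k with k + 3, and k + 1 with k + 2. In one block this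
links the vertices 4j, 4j + 3, 4j + 2, 4j + 1, 4j + 4 in turn. -/
theorem mk_vertex {k : ℕ} (hk : k ≤ 4 * d) :
    (Quot.mk _ (boundaryPoint d k) : PolygonSurface d) = Quot.mk _ (boundaryPoint d (0 : ℕ)) := by
  have h0 : ∀ k < 4 * d, k % 4 < 2 → (Quot.mk _ (boundaryPoint d k) : PolygonSurface d) =
      Quot.mk _ (boundaryPoint d (k + 3 : ℕ)) := fun k hk hk4 => by
    simpa using boundaryPoint_gluing hk hk4 (t := 0) (by simp)
  have h1 : ∀ k < 4 * d, k % 4 < 2 → (Quot.mk _ (boundaryPoint d (k + 1 : ℕ)) :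
      PolygonSurface d) = Quot.mk _ (boundaryPoint d (k + 2 : ℕ)) := fun k hk hk4 => by
    have h2 : (k : ℝ) + 3 - 1 = ((k + 2 : ℕ) : ℝ) := by push_cast; ring
    simpa [h2] using boundaryPoint_gluing hk hk4 (t := 1) (by simp)
  have hj : ∀ j ≤ d, (Quot.mk _ (boundaryPoint d (4 * j : ℕ)) : PolygonSurface d) =
      Quot.mk _ (boundaryPoint d (0 : ℕ)) := by
    intro j
    induction j with
    | zero => intro _; rfl
    | succ j ih =>
      intro hj
      rw [← ih (by omega), h0 (4 * j) (by omega) (by omega),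
        ← h1 (4 * j + 1) (by omega) (by omega), ← h1 (4 * j) (by omega) (by omega),
        h0 (4 * j + 1) (by omega) (by omega)]
      rfl
  obtain ⟨j, r, hr, rfl⟩ : ∃ j r, r < 4 ∧ k = 4 * j + r :=
    ⟨k / 4, k % 4, Nat.mod_lt _ (by norm_num), (Nat.div_add_mod k 4).symm⟩
  interval_cases r
  · exact hj j (by omega)
  · rw [← hj (j + 1) (by omega), h0 _ (by omega) (by omega)]
    rfl
  · rw [← hj j (by omega), h0 (4 * j) (by omega) (by omega),
      ← h1 (4 * j + 1) (by omega) (by omega)]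
  · rw [← hj j (by omega), h0 (4 * j) (by omega) (by omega)]

/-- The holonomy relation along two sides of the polygon which are glued together. -/
theorem holonomyAlong_gluing [SimplyConnectedSpace Disc] {x₀ : PolygonSurface d}
    (τ : ∀ x, Path.Homotopic.Quotient x₀ x) (p : C(Disc, PolygonSurface d))
    (hp : ∀ y, p y = Quot.mk _ y) (y₀ : Disc) {k : ℕ} (hk : k < 4 * d) (hk4 : k % 4 < 2) {t : ℝ}
    (ht : t ∈ Set.Icc (0 : ℝ) 1) :
    holonomyAlong τ p y₀ (boundaryPoint d (k + t)) *
      (holonomyAlong τ p y₀ (boundaryPoint d (k + 3 - t)))⁻¹ =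
    holonomyAlong τ p y₀ (boundaryPoint d k) *
      (holonomyAlong τ p y₀ (boundaryPoint d (k + 3 : ℕ)))⁻¹ := by
  have hcont := continuous_boundaryPoint d
  let γ : Path (boundaryPoint d k) (boundaryPoint d (k + t)) :=
    { toFun := fun s => boundaryPoint d (k + s * t)
      continuous_toFun := hcont.comp (by fun_prop)
      source' := by simp
      target' := by simp }
  let δ : Path (boundaryPoint d (k + 3 : ℕ)) (boundaryPoint d (k + 3 - t)) :=
    { toFun := fun s => boundaryPoint d (k + 3 - s * t)
      continuous_toFun := hcont.comp (by fun_prop)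
      source' := by simp
      target' := by simp }
  have h : holonomyAlong τ p (boundaryPoint d k) (boundaryPoint d (k + t)) =
      holonomyAlong τ p (boundaryPoint d (k + 3 : ℕ)) (boundaryPoint d (k + 3 - t)) := by
    rw [holonomyAlong_eq τ p γ, holonomyAlong_eq τ p δ]
    refine holonomy_congr τ _ _ fun s => ?_
    change p (boundaryPoint d (k + s * t)) = p (boundaryPoint d (k + 3 - s * t))
    rw [hp, hp]
    exact boundaryPoint_gluing hk hk4
      ⟨mul_nonneg s.2.1 ht.1, mul_le_one₀ s.2.2 ht.1 ht.2⟩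
  rw [← holonomyAlong_mul τ p y₀ (boundaryPoint d k) (boundaryPoint d (k + t)),
    ← holonomyAlong_mul τ p y₀ (boundaryPoint d (k + 3 : ℕ)) (boundaryPoint d (k + 3 - t)), h]
  group

/-- The fundamental group of the polygon surface has the standard presentation. -/
theorem exists_isSurfaceBasis_polygonSurface (hd : 1 ≤ d) :
    ∃ a b : Fin d → FundamentalGroup (PolygonSurface d) (Quot.mk _ (boundaryPoint d (0 : ℕ))),
      IsSurfaceBasis.{u} a b := by
  have := contractibleSpace_disc
  set y₀ : Disc := boundaryPoint d (0 : ℕ) with hy₀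
  have hq : IsQuotientMap (Quot.mk (PolygonGluing d)) := isQuotientMap_quot_mk
  let p : C(Disc, PolygonSurface d) := ⟨Quot.mk _, hq.continuous⟩
  obtain ⟨τ, hτ, hτ'⟩ := exists_connecting_paths p hq.surjective y₀
  let V : ℕ → FundamentalGroup (PolygonSurface d) (p y₀) := fun k =>
    holonomyAlong τ p y₀ (boundaryPoint d k)
  have hV0 : V 0 = 1 := holonomyAlong_self τ p y₀
  have hV : ∀ (k : ℕ) (δ : Path y₀ (boundaryPoint d k)) (h : p (boundaryPoint d k) = p y₀),
      V k = (FundamentalGroup.fromPath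
        ((Path.Homotopic.Quotient.mk (δ.map hq.continuous)).cast rfl h.symm))⁻¹ := by
    intro k δ h
    change holonomyAlong τ p y₀ (boundaryPoint d k) = _
    rw [holonomyAlong_eq τ p δ]
    exact holonomy_eq_inv hτ _ h.symm
  -- The parameters 4d and 0 give the same point of the circle; this is the source of the surface
  -- relation.
  have hV4 : V (4 * d) = 1 := by
    have h : boundaryPoint d (4 * d : ℕ) = y₀ :=
      (boundaryPoint_eq_iff hd).2 ⟨1, by push_cast; ring⟩
    change holonomyAlong τ p y₀ (boundaryPoint d (4 * d : ℕ)) = 1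
    rw [h]
    exact hV0
  have hVrel : ∀ k < 4 * d, k % 4 < 2 → V (k + 1) * (V (k + 2))⁻¹ = V k * (V (k + 3))⁻¹ := by
    intro k hk hk4
    have h1 := holonomyAlong_gluing τ p (fun _ => rfl) y₀ hk hk4 (t := 1) (by simp)
    have h2 : (k : ℝ) + 3 - 1 = ((k + 2 : ℕ) : ℝ) := by push_cast; ring
    have h3 : (k : ℝ) + 1 = ((k + 1 : ℕ) : ℝ) := by push_cast; ring
    rw [h2, h3] at h1
    exact h1
  let a : Fin d → FundamentalGroup (PolygonSurface d) (p y₀) := fun j =>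
    (V (4 * j))⁻¹ * V (4 * j + 1)
  let b : Fin d → FundamentalGroup (PolygonSurface d) (p y₀) := fun j =>
    (V (4 * j + 1))⁻¹ * V (4 * j + 2)
  have hVs : ∀ j : Fin d, V (4 * j + 1) = V (4 * j) * a j ∧
      V (4 * j + 2) = V (4 * j + 1) * b j ∧ V (4 * j + 3) = V (4 * j + 2) * (a j)⁻¹ ∧
      V (4 * j + 4) = V (4 * j + 3) * (b j)⁻¹ := by
    intro j
    have h1 := hVrel (4 * j) (by omega) (by omega)
    have h2 := hVrel (4 * j + 1) (by omega) (by omega)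
    exact ⟨(mul_inv_cancel_left _ _).symm, (mul_inv_cancel_left _ _).symm,
      eq_mul_inv_of_mul_inv_eq h1, eq_mul_inv_of_mul_inv_eq h2⟩
  refine ⟨a, b, ?_, ?_, ?_⟩
  · refine eq_top_of_locally_contractible τ hq (polygonSurface_locally_contractible hd) hτ y₀ _ ?_
    set S := Subgroup.closure (Set.range a ∪ Set.range b) with hS
    have haS : ∀ j, a j ∈ S := fun j => Subgroup.subset_closure (.inl ⟨j, rfl⟩)
    have hbS : ∀ j, b j ∈ S := fun j => Subgroup.subset_closure (.inr ⟨j, rfl⟩)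
    have h4 : ∀ j ≤ d, V (4 * j) ∈ S := by
      intro j
      induction j with
      | zero => intro _; rw [mul_zero, hV0]; exact one_mem S
      | succ j ih =>
        intro hj
        obtain ⟨h1, h2, h3, h4⟩ := hVs ⟨j, hj⟩
        have := ih (by omega)
        rw [mul_add, mul_one, h4, h3, h2, h1]
        exact mul_mem (mul_mem (mul_mem (mul_mem this (haS _)) (hbS _)) (inv_mem (haS _)))
          (inv_mem (hbS _))
    have hVS : ∀ k ≤ 4 * d, V k ∈ S := by
      intro k hk
      rcases hk.eq_or_lt with rfl | hk
      · rw [hV4]; exact one_mem S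
      obtain ⟨j, r, hr, rfl⟩ : ∃ j r, r < 4 ∧ k = 4 * j + r :=
        ⟨k / 4, k % 4, Nat.mod_lt _ (by norm_num), (Nat.div_add_mod k 4).symm⟩
      have hj : j < d := by omega
      obtain ⟨h1, h2, h3, -⟩ := hVs ⟨j, hj⟩
      have h0 := h4 j hj.le
      have h1' : V (4 * j + 1) ∈ S := by rw [h1]; exact mul_mem h0 (haS _)
      have h2' : V (4 * j + 2) ∈ S := by rw [h2]; exact mul_mem h1' (hbS _)
      interval_cases r
      · exact h0
      · exact h1'
      · exact h2'
      · rw [h3]; exact mul_mem h2' (inv_mem (haS _))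
    intro y
    obtain ⟨z, hz, hz1⟩ := hτ' (p y)
    -- Here `z` is the point over `p y` with trivial holonomy. A gluing multiplies the holonomy on
    -- the left by V k (V (k + 3))⁻¹ or its inverse, which lies in `S`.
    have h5 : holonomyAlong τ p y₀ y * (holonomyAlong τ p y₀ z)⁻¹ ∈ S := by
      refine (iff_of_mk_eq (Q := fun y => holonomyAlong τ p y₀ y *
        (holonomyAlong τ p y₀ z)⁻¹ ∈ S) (fun u v huv => ?_) hz).1
        (by rw [mul_inv_cancel]; exact one_mem S)
      obtain ⟨k, hk, hk4, t, ht, rfl, rfl⟩ := polygonGluing_iff.1 huv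
      have h6 := holonomyAlong_gluing τ p (fun _ => rfl) y₀ hk hk4 ht
      have h7 : V k * (V (k + 3))⁻¹ ∈ S := mul_mem (hVS k hk.le) (inv_mem (hVS _ (by omega)))
      rw [mul_inv_eq_iff_eq_mul] at h6
      rw [h6, mul_assoc]
      exact mul_mem_cancel_left h7
    rw [hz1, inv_one, mul_one] at h5
    exact h5
  · rw [prod_ofFn_eq_of_succ _ (fun j => V (4 * j)) hV0 fun j => ?_, hV4]
    obtain ⟨h1, h2, h3, h4⟩ := hVs j
    rw [mul_add, mul_one, h4, h3, h2, h1]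
    simp only [commutatorElement_def, mul_assoc]
  · intro H _ a' b' hab
    -- Vertex k is labelled by the product of the first k letters. The assumed relation makes the
    -- label return to 1 after 4d sides, and successive quotients of labels recover the letters.
    let M := surfacePrefix a' b'
    have hM0 : M 0 = 1 := rfl
    have hM : M (4 * d) = M 0 := (surfacePrefix_four_mul a' b').trans hab
    have hc := isQuotientCoveringMap_boundaryLabel hM
      (fun k _ hk4 => surfacePrefix_relation a' b' hk4) hd
    have hy₀M : boundaryLabel d M y₀ = 1 := boundaryLabel_vertex hM hd (Nat.zero_le _)
    obtain ⟨f, hf⟩ := TwistedCover.exists_hom hc hq.continuous hy₀M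
    have hfV : ∀ k ≤ 4 * d, f (V k) = M k := by
      intro k hk
      rw [hV k (PathConnectedSpace.somePath _ _) (mk_vertex hk), hf _ (mk_vertex hk)]
      exact boundaryLabel_vertex hM hd hk
    refine ⟨f, fun j => ?_, fun j => ?_⟩
    · rw [map_mul, map_inv, hfV _ (by omega), hfV _ (by omega)]
      change (surfacePrefix a' b' _)⁻¹ * surfacePrefix a' b' _ = _
      rw [surfacePrefix_succ, inv_mul_cancel_left, surfaceLetter_four_mul]
    · rw [map_mul, map_inv, hfV _ (by omega), hfV _ (by omega)]
      change (surfacePrefix a' b' _)⁻¹ * surfacePrefix a' b' _ = _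
      rw [surfacePrefix_succ a' b' (4 * j + 1), inv_mul_cancel_left, surfaceLetter_four_mul_add_one]

end Presentation

/-! ### Transfer to an arbitrary surface and base point, and the conclusion -/

section Homeomorph

open FundamentalGroupoidFunctor in
/-- Homeomorphic spaces have isomorphic fundamental groups. -/
noncomputable def Homeomorph.fundamentalGroupMulEquiv {X Y : Type*} [TopologicalSpace X]
    [TopologicalSpace Y] (e : X ≃ₜ Y) (x : X) :
    FundamentalGroup X x ≃* FundamentalGroup Y (e x) :=
  (equivOfHomotopyEquiv e.toHomotopyEquiv).fullyFaithfulFunctor.mulEquivEnd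
    (FundamentalGroupoid.mk x)

theorem IsClosedOrientableSurfaceOfGenus.exists_isSurfaceBasis {W : Type*} [TopologicalSpace W]
    {d : ℕ} (hW : IsClosedOrientableSurfaceOfGenus W d) (hd : 1 ≤ d) (w : W) :
    ∃ a b : Fin d → FundamentalGroup W w, IsSurfaceBasis.{u} a b := by
  rw [IsClosedOrientableSurfaceOfGenus, if_neg (by omega)] at hW
  obtain ⟨e⟩ := hW
  obtain ⟨a, b, h⟩ := exists_isSurfaceBasis_polygonSurface.{u} hd
  have := contractibleSpace_disc
  have : PathConnectedSpace (PolygonSurface d) :=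
    Quot.mk_surjective.pathConnectedSpace continuous_quot_mk
  have : PathConnectedSpace W := e.symm.surjective.pathConnectedSpace e.symm.continuous
  have h' := h.map ((e.symm.fundamentalGroupMulEquiv _).trans
    (FundamentalGroup.fundamentalGroupMulEquivOfPathConnected _ w))
  exact ⟨_, _, h'⟩

end Homeomorph

theorem theorem1p3p2 {W G G' : Type*} [TopologicalSpace W] [Group G] [Group G']
    (d : ℕ) (hd : 1 ≤ d) (hW : IsClosedOrientableSurfaceOfGenus W d) (w : W)
    (q : G' →* G) (hq : Function.Surjective q) (hΓ : Finite q.ker)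
    (g : FundamentalGroup W w →* G) :
    (homLifts q g).Finite ∧
      Nat.card q.ker * Nat.card (Subgroup.center q.ker) ^ (2 * d - 2) ∣
        (homLifts q g).ncard := by
  obtain ⟨a, b, h⟩ := hW.exists_isSurfaceBasis hd w
  choose α hα using fun i => hq (g (a i))
  choose β hβ using fun i => hq (g (b i))
  let E := h.homLiftsEquiv q g hα hβ
  have := Fintype.ofFinite q.ker
  refine ⟨(have := Finite.of_equiv _ E.symm; Set.toFinite _), ?_⟩
  rw [← Nat.card_coe_set_eq, Nat.card_congr E, sum_prod_commutator_eq_commutatorCount]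
  -- One pair is split off, and the remaining d - 1 pairs give the exponent 2(d - 1).
  obtain ⟨m, rfl⟩ : ∃ m, d = m + 1 := ⟨d - 1, by omega⟩
  rw [List.ofFn_succ]
  convert card_mul_card_center_pow_dvd_commutatorCount (K := q.ker) _ _ using 3
  rw [List.length_ofFn]
  omega
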